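/- All graphs are finite, simple and undirected. For a graph $G$ let $\Delta(G)$ denote its maximum degree, $\omega(G)$ the number of vertices of a largest clique of $G$, and $\chi(G)$ its chromatic number. The chair (also called the fork) is the graph on five vertices $a,b,c,d,e$ with edge set $\{ab, ac, ad, de\}$, that is, the claw $K_{1,3}$ with one edge subdivided once. A graph is chair-free if it has no induced subgraph isomorphic to the chair. Let $G$ be a chair-free graph with $\Delta(G) \ge 9$. Then $$\chi(G) \le \max\{\Delta(G)-1,\ \omega(G)\}.$$ That is, the Borodin--Kostochka conjecture holds for chair-free graphs. -/

import Mathlib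

/-- The chair (also called the fork): the graph on five vertices obtained from the claw with
centre `0` and leaves `1`, `2`, `3` by attaching a pendant vertex `4` to the leaf `3`. -/
def chairGraph : SimpleGraph (Fin 5) :=
  SimpleGraph.fromEdgeSet {s(0, 1), s(0, 2), s(0, 3), s(3, 4)}

/-- A graph is chair-free if no induced subgraph of it is isomorphic to the chair. -/
def IsChairFree {V : Type*} (G : SimpleGraph V) : Prop :=
  ¬ chairGraph.IsIndContained G

/-!
With `k = max (Δ - 1) ω`, the claim is that a chair-free graph with all degrees at most `k + 1`, no
clique on `k + 1` vertices and `k ≥ 8` is `k`-colourable; the case of Brooks' theorem, `ω = Δ`, is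
included. In a minimal counterexample every `G - v` has a `k`-colouring, called here a near-colouring
at `v`. Every colour appears on `N(v)`, and since `v` has at most `k + 1` neighbours, at most one
colour appears there twice (`IsNearColoring.not_two_redundant`). A neighbour `u` whose colour is not
repeated can pass its colour to `v` and become the uncoloured vertex itself
(`IsNearColoring.shift`), so the same restrictions hold around `u`.

Let `u` and `w` be non-adjacent neighbours of `v` with unrepeated colours. As in edge colouring, the
Kempe chain from `u` must reach `w`, and chair-freeness, with the uncoloured vertex `v` as part of
the forbidden chair, makes this chain a path (`IsNearColoring.exists_two_kempe_adj`). An argument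
in the manner of Vizing's fans shows that the chains from several such `u` to a common `w` all pass
through the same second vertex, around which too many colours would be repeated as soon as there are
three of them. So `w` has at most two non-neighbours among the neighbours with unrepeated colour
(`IsNearColoring.not_three_nonadj`), and the neighbourhood of `v` is dense.

In a dense neighbourhood two non-adjacent vertices `x`, `y` with unrepeated colours have a free
colour in common once `v` and its neighbours with unrepeated colours are uncoloured (this is where
`k ≥ 8` is used). Giving them this colour makes room for a greedy colouring of the others
(`IsNearColoring.sole_adj`). Hence the neighbours with unrepeated colour form a clique, and `N(v)`
consists of a clique `U` on `k - 1` vertices and two non-adjacent vertices `p`, `q` that together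
dominate `U`.

If both `p` and `q` have several neighbours in `U`, a similar recolouring succeeds
(`IsCliqueSplit.not_large`). Otherwise exactly one edge at `v` is weak, with a single common
neighbour of its ends, while the ends of all others have at least `k - 2` common neighbours. The
common neighbour of the two ends of a weak edge then has too large a degree
(`false_of_critical`).
-/

namespace ChairFree

open Finset

/-! ### Near-colourings -/

section

variable {V : Type*} {G : SimpleGraph V} {k : ℕ} {φ : V → Option (Fin k)} {v : V}

/-- Only `b ≠ c` has to be assumed: the other vertices are told apart by their adjacencies. -/
lemma false_of_chair (hG : IsChairFree G) {a b c d e : V} (hab : G.Adj a b) (hac : G.Adj a c)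
    (had : G.Adj a d) (hde : G.Adj d e) (hbc : ¬ G.Adj b c) (hbd : ¬ G.Adj b d)
    (hcd : ¬ G.Adj c d) (hea : ¬ G.Adj e a) (heb : ¬ G.Adj e b) (hec : ¬ G.Adj e c)
    (hne : b ≠ c) : False := by
  have h1 : b ≠ d := by rintro rfl; exact heb hde.symm
  have h2 : c ≠ d := by rintro rfl; exact hec hde.symm
  have h3 : e ≠ a := by rintro rfl; exact heb hab
  have h4 : e ≠ b := by rintro rfl; exact hea hab.symm
  have h5 : e ≠ c := by rintro rfl; exact hea hac.symm
  have hba := hab.symm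
  have hca := hac.symm
  have hda := had.symm
  have hed := hde.symm
  rw [G.adj_comm] at hbc hbd hcd hea heb hec
  refine hG ⟨⟨⟨![a, b, c, d, e], ?_⟩, ?_⟩⟩
  · intro i j hij
    have := hab.ne; have := hac.ne; have := had.ne; have := hde.ne
    fin_cases i <;> fin_cases j <;> simp_all
  · intro i j
    change G.Adj (![a, b, c, d, e] i) (![a, b, c, d, e] j) ↔ _
    have e1 := hbc ∘ SimpleGraph.Adj.symm
    have e2 := hbd ∘ SimpleGraph.Adj.symm
    have e3 := hcd ∘ SimpleGraph.Adj.symm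
    have e4 := hea ∘ SimpleGraph.Adj.symm
    have e5 := heb ∘ SimpleGraph.Adj.symm
    have e6 := hec ∘ SimpleGraph.Adj.symm
    fin_cases i <;> fin_cases j <;> simp_all [chairGraph]

/-- A proper colouring of the subgraph induced by the vertices with `ψ x ≠ none`. -/
def IsPartialColoring (G : SimpleGraph V) (ψ : V → Option (Fin k)) : Prop :=
  ∀ x y, G.Adj x y → ∀ c, ψ x = some c → ψ y ≠ some c

/-- A proper `k`-colouring of `G - v`, extended by `none` at `v`. Since `none` is used nowhere else,
it is a proper colouring of `G` with `Option (Fin k)` as the set of colours. -/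
structure IsNearColoring (G : SimpleGraph V) (φ : V → Option (Fin k)) (v : V) : Prop where
  proper : ∀ x y, G.Adj x y → φ x ≠ φ y
  none_iff : ∀ x, φ x = none ↔ x = v

/-- `u` is the only neighbour of `v` with its colour. -/
def IsSole (G : SimpleGraph V) (φ : V → Option (Fin k)) (v u : V) : Prop :=
  G.Adj v u ∧ ∀ x, G.Adj v x → φ x = φ u → x = u

lemma IsSole.ne_color {u w : V} (hu : IsSole G φ v u) (hw : IsSole G φ v w) (hne : u ≠ w) :
    φ u ≠ φ w := fun h => hne (hw.2 u hu.1 h)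

lemma IsNearColoring.ne_none (h : IsNearColoring G φ v) {x : V} (hx : x ≠ v) : φ x ≠ none :=
  fun h' => hx ((h.none_iff x).1 h')

lemma IsPartialColoring.exists_eq_none (hN : ¬ G.Colorable k) {ψ : V → Option (Fin k)}
    (hψ : IsPartialColoring G ψ) : ∃ x, ψ x = none := by
  by_contra! hall
  have hs : ∀ x, ∃ c, ψ x = some c := fun x => Option.ne_none_iff_exists'.1 (hall x)
  choose f hf using hs
  refine hN ⟨SimpleGraph.Coloring.mk f ?_⟩
  intro x y hxy he
  exact hψ x y hxy (f x) (hf x) (by rw [hf y, he])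

lemma IsNearColoring.exists_adj_eq [DecidableEq V] (hN : ¬ G.Colorable k)
    (h : IsNearColoring G φ v) (c : Fin k) : ∃ u, G.Adj v u ∧ φ u = some c := by
  by_contra! hc
  have hp : IsPartialColoring G (Function.update φ v (some c)) := by
    intro x y hxy d hx hy
    by_cases hxv : x = v
    · subst hxv
      rw [Function.update_self] at hx
      rw [Function.update_of_ne hxy.ne'] at hy
      exact hc y hxy (hy.trans hx.symm)
    · rw [Function.update_of_ne hxv] at hx
      by_cases hyv : y = v
      · subst hyv
        rw [Function.update_self] at hy
        exact hc x hxy.symm (hx.trans hy.symm)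
      · rw [Function.update_of_ne hyv] at hy
        exact h.proper x y hxy (hx.trans hy.symm)
  obtain ⟨x, hx⟩ := hp.exists_eq_none hN
  by_cases hxv : x = v
  · subst hxv; simp at hx
  · rw [Function.update_of_ne hxv] at hx
    exact h.ne_none hxv hx

/-- Moving the uncoloured vertex from `v` to a neighbour `u` whose colour is unique at `v`. -/
lemma IsNearColoring.shift [DecidableEq V] (h : IsNearColoring G φ v) {u : V}
    (hu : IsSole G φ v u) : IsNearColoring G (φ ∘ Equiv.swap v u) u := by
  have key : ∀ y, G.Adj v y → y ≠ u → φ u ≠ φ y := fun y hy hne he => hne (hu.2 y hy he.symm)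
  have keyn : ∀ y, y ≠ v → φ v ≠ φ y := fun y hy he =>
    h.ne_none hy (he.symm.trans ((h.none_iff v).2 rfl))
  constructor
  · intro x y hxy
    simp only [Function.comp_apply, Equiv.swap_apply_def]
    have := hxy.ne
    split_ifs with h1 h2 h3 h4 h5 h6 h7 h8
    · exact absurd (h1.trans h2.symm) this
    · exact keyn u hu.1.ne' |>.symm
    · subst h1; exact key y hxy h3
    · exact keyn u hu.1.ne'
    · exact absurd (h4.trans h6.symm) this
    · exact keyn y h5
    · subst h7; exact (key x hxy.symm h4).symm
    · exact (keyn x h1).symm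
    · exact h.proper x y hxy
  · intro x
    rw [Function.comp_apply, h.none_iff, Equiv.swap_apply_eq_iff, Equiv.swap_apply_left]

lemma comp_swap_apply_of_ne [DecidableEq V] (φ : V → Option (Fin k)) {u x : V}
    (hv : x ≠ v) (hu : x ≠ u) : (φ ∘ Equiv.swap v u) x = φ x := by
  rw [Function.comp_apply, Equiv.swap_apply_of_ne_of_ne hv hu]

/-- A neighbour `u` whose colour is unique at `v` sees every other colour, because the uncoloured
vertex can be moved to `u`. -/
lemma IsNearColoring.exists_adj_eq_of_isSole [DecidableEq V] (hN : ¬ G.Colorable k)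
    (h : IsNearColoring G φ v) {u w : V} (hu : IsSole G φ v u) (hw : w ≠ v) (hwu : φ w ≠ φ u) :
    ∃ s, G.Adj u s ∧ φ s = φ w := by
  obtain ⟨c, hc⟩ := Option.ne_none_iff_exists'.1 (h.ne_none hw)
  obtain ⟨s, hus, hs⟩ := (h.shift hu).exists_adj_eq hN c
  by_cases hsv : s = v
  · subst hsv
    rw [Function.comp_apply, Equiv.swap_apply_left] at hs
    exact absurd (hc.trans hs.symm) hwu
  · rw [comp_swap_apply_of_ne φ hsv hus.ne'] at hs
    exact ⟨s, hus, hs.trans hc.symm⟩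

/-- If `u` and `w` are not adjacent and both have a colour that is unique at `v`, then `u` sees
the colour of `w` exactly once: two such neighbours of `u` would give a chair centred at `u` with
leaves these two and `v`, and `w` pendant at `v`. -/
lemma IsNearColoring.existsUnique_adj_eq [DecidableEq V] (hG : IsChairFree G)
    (hN : ¬ G.Colorable k) (h : IsNearColoring G φ v) {u w : V} (hu : IsSole G φ v u)
    (hw : IsSole G φ v w) (hne : u ≠ w) (huw : ¬ G.Adj u w) :
    ∃ s, G.Adj u s ∧ φ s = φ w ∧ ∀ t, G.Adj u t → φ t = φ w → t = s := by
  obtain ⟨s, hus, hs⟩ := h.exists_adj_eq_of_isSole hN hu hw.1.ne' (hu.ne_color hw hne).symm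
  refine ⟨s, hus, hs, fun t hut ht => ?_⟩
  by_contra hts
  have hnv : ∀ x, G.Adj u x → φ x = φ w → ¬ G.Adj v x := by
    intro x hx hxw hvx
    exact huw (hw.2 x hvx hxw ▸ hx)
  exact false_of_chair hG hut hus hu.1.symm hw.1
    (fun ha => h.proper _ _ ha (ht.trans hs.symm)) (fun ha => hnv t hut ht ha.symm)
    (fun ha => hnv s hus hs ha.symm) (fun ha => huw ha.symm)
    (fun ha => h.proper _ _ ha ht.symm) (fun ha => h.proper _ _ ha hs.symm) hts

/-- Moving the uncoloured vertex from `v` through `u` to the next vertex `s` of the chain from `u`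
to `w`. -/
lemma IsNearColoring.shift_shift [DecidableEq V] (h : IsNearColoring G φ v) {u w s : V}
    (hu : IsSole G φ v u) (hw : IsSole G φ v w) (hne : u ≠ w) (hus : G.Adj u s) (hs : φ s = φ w)
    (hs' : ∀ x, G.Adj u x → φ x = φ w → x = s) :
    IsNearColoring G ((φ ∘ Equiv.swap v u) ∘ Equiv.swap u s) s := by
  have hsv : s ≠ v := by
    rintro rfl
    exact h.ne_none hw.1.ne' (hs.symm.trans ((h.none_iff s).2 rfl))
  refine (h.shift hu).shift ⟨hus, fun x hx hxs => ?_⟩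
  rw [comp_swap_apply_of_ne φ hsv hus.ne', hs] at hxs
  by_cases hxv : x = v
  · subst hxv
    rw [Function.comp_apply, Equiv.swap_apply_left] at hxs
    exact absurd hxs (hu.ne_color hw hne)
  · rw [comp_swap_apply_of_ne φ hxv hx.ne'] at hxs
    exact hs' x hx hxs

/-- The chain from `u` to `w` does not end at its second vertex `s`. -/
lemma IsNearColoring.exists_second [DecidableEq V] (hN : ¬ G.Colorable k)
    (h : IsNearColoring G φ v) {u w s : V} (hu : IsSole G φ v u) (hw : IsSole G φ v w)
    (hne : u ≠ w) (huw : ¬ G.Adj u w)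
    (hus : G.Adj u s) (hs : φ s = φ w) (hs' : ∀ x, G.Adj u x → φ x = φ w → x = s) :
    ∃ y, G.Adj s y ∧ y ≠ u ∧ φ y = φ u := by
  have hvs : ¬ G.Adj v s := fun hv => huw (hw.2 s hv hs ▸ hus)
  have hsv : s ≠ v := by
    rintro rfl
    exact h.ne_none hw.1.ne' (hs.symm.trans ((h.none_iff s).2 rfl))
  obtain ⟨c, hc⟩ := Option.ne_none_iff_exists'.1 (h.ne_none hu.1.ne')
  obtain ⟨y, hsy, hy⟩ := (h.shift_shift hu hw hne hus hs hs').exists_adj_eq hN c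
  have hyv : y ≠ v := by
    rintro rfl
    exact hvs hsy.symm
  have hyu : y ≠ u := by
    rintro rfl
    rw [Function.comp_apply, Equiv.swap_apply_left,
      comp_swap_apply_of_ne φ hsv hus.ne'] at hy
    exact hu.ne_color hw hne (hc.trans (hy.symm.trans hs))
  rw [comp_swap_apply_of_ne _ hyu hsy.ne',
    comp_swap_apply_of_ne φ hyv hyu] at hy
  exact ⟨y, hsy, hyu, hy.trans hc.symm⟩

/-! ### Kempe chains -/

/-- The subgraph of `G` formed by the edges with end colours `c` and `d`. -/
def kempe (G : SimpleGraph V) (φ : V → Option (Fin k)) (c d : Option (Fin k)) : SimpleGraph V where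
  Adj x y := G.Adj x y ∧ (φ x = c ∧ φ y = d ∨ φ x = d ∧ φ y = c)
  symm := ⟨fun _ _ h => ⟨h.1.symm, h.2.symm.imp And.symm And.symm⟩⟩
  loopless := ⟨fun _ h => h.1.ne rfl⟩

/-- If the component of `u` did not contain `w`, exchanging the two colours on it would free the
colour of `u` for `v`. -/
lemma IsNearColoring.reachable_kempe [DecidableEq V] (hN : ¬ G.Colorable k)
    (h : IsNearColoring G φ v) {u w : V} (hu : IsSole G φ v u) (hw : IsSole G φ v w) :
    (kempe G φ (φ u) (φ w)).Reachable u w := by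
  classical
  by_contra hr
  set K := kempe G φ (φ u) (φ w)
  have hun := h.ne_none hu.1.ne'
  have hwn := h.ne_none hw.1.ne'
  let ψ : V → Option (Fin k) := fun x =>
    if K.Reachable u x then Equiv.swap (φ u) (φ w) (φ x) else φ x
  have hmem : ∀ x, K.Reachable u x → φ x = φ u ∨ φ x = φ w := by
    intro x hx
    obtain ⟨p⟩ := hx.symm
    cases p with
    | nil => exact Or.inl rfl
    | cons hadj _ => exact hadj.2.imp And.left And.left
  have hswap : ∀ x, K.Reachable u x → φ u ≠ φ w → ∀ y, G.Adj x y → ¬ K.Reachable u y →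
      Equiv.swap (φ u) (φ w) (φ x) ≠ φ y := by
    intro x hx _ y hxy hy he
    apply hy
    refine hx.trans (SimpleGraph.Adj.reachable ⟨hxy, ?_⟩)
    rcases hmem x hx with h1 | h1
    · rw [h1, Equiv.swap_apply_left] at he
      exact Or.inl ⟨h1, he.symm⟩
    · rw [h1, Equiv.swap_apply_right] at he
      exact Or.inr ⟨h1, he.symm⟩
  have hne : φ u ≠ φ w := hu.ne_color hw (by rintro rfl; exact hr (SimpleGraph.Reachable.refl _))
  have hψ : IsNearColoring G ψ v := by
    constructor
    · intro x y hxy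
      simp only [ψ]
      split_ifs with h1 h2 h2
      · exact fun he => h.proper x y hxy ((Equiv.swap _ _).injective he)
      · exact hswap x h1 hne y hxy h2
      · exact (hswap y h2 hne x hxy.symm h1).symm
      · exact h.proper x y hxy
    · intro x
      rw [← h.none_iff]
      simp only [ψ]
      split_ifs with h1
      · rw [Equiv.swap_apply_eq_iff, Equiv.swap_apply_of_ne_of_ne hun.symm hwn.symm]
      · rfl
  obtain ⟨c, hc⟩ := Option.ne_none_iff_exists'.1 hun
  obtain ⟨y, hvy, hy⟩ := hψ.exists_adj_eq hN c
  rw [← hc] at hy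
  simp only [ψ] at hy
  split_ifs at hy with h1
  · rw [Equiv.swap_apply_eq_iff, Equiv.swap_apply_left] at hy
    exact hr (hw.2 y hvy hy ▸ h1)
  · exact h1 (hu.2 y hvy hy ▸ SimpleGraph.Reachable.refl _)

/-- The Kempe chain through two non-adjacent vertices `u`, `w` with colours unique at `v` is a path
with ends `u` and `w`: a branching vertex would be the centre of a chair whose long leg runs back
along the path (and, next to `u`, ends in `v`). Hence every other vertex of the chain has two
neighbours on it. -/
lemma IsNearColoring.exists_two_kempe_adj [DecidableEq V] (hG : IsChairFree G)
    (hN : ¬ G.Colorable k) (h : IsNearColoring G φ v) {u w s : V} (hu : IsSole G φ v u)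
    (hw : IsSole G φ v w) (hne : u ≠ w) (huw : ¬ G.Adj u w)
    (hs : (kempe G φ (φ u) (φ w)).Reachable u s) (hsu : s ≠ u) (hsw : s ≠ w) :
    ∃ y z, y ≠ z ∧ (kempe G φ (φ u) (φ w)).Adj s y ∧ (kempe G φ (φ u) (φ w)).Adj s z := by
  have hcol := hu.ne_color hw hne
  set K := kempe G φ (φ u) (φ w) with hK
  obtain ⟨p, hp⟩ := (h.reachable_kempe hN hu hw).exists_isPath
  set x : ℕ → V := p.getVert with hx
  set n := p.length with hn
  have hx0 : x 0 = u := p.getVert_zero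
  have hxn : x n = w := p.getVert_length
  have hadj : ∀ i, i < n → K.Adj (x i) (x (i + 1)) := fun i hi => p.adj_getVert_succ hi
  have hinj : ∀ i j, i ≤ n → j ≤ n → x i = x j → i = j :=
    fun i j hi hj he => hp.getVert_injOn hi hj he
  have hsame : ∀ a b c, K.Adj a b → K.Adj a c → φ b = φ c := by
    rintro a b c ⟨_, h1⟩ ⟨_, h2⟩
    rcases h1 with h1 | h1 <;> rcases h2 with h2 | h2
    · rw [h1.2, h2.2]
    · exact absurd (h1.1.symm.trans h2.1) hcol
    · exact absurd (h2.1.symm.trans h1.1) hcol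
    · rw [h1.2, h2.2]
  have hKof : ∀ a b e, K.Adj a b → φ e = φ a → G.Adj e b → K.Adj e b := by
    rintro a b e ⟨_, h1⟩ he heb
    exact ⟨heb, by rwa [he]⟩
  have hnonadj : ∀ a b c, K.Adj a b → K.Adj a c → ¬ G.Adj b c :=
    fun a b c h1 h2 h3 => h.proper _ _ h3 (hsame a b c h1 h2)
  have hend : ∀ a b, IsSole G φ v a → IsSole G φ v b → a ≠ b → ¬ G.Adj a b →
      ∀ y z, G.Adj a y → φ y = φ b → G.Adj a z → φ z = φ b → y = z := by
    intro a b ha hb hab hadj' y z hy1 hy2 hz1 hz2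
    obtain ⟨t, -, -, ht⟩ := h.existsUnique_adj_eq hG hN ha hb hab hadj'
    rw [ht y hy1 hy2, ht z hz1 hz2]
  have hfromu : ∀ y, K.Adj u y → φ y = φ w := fun y hy =>
    hy.2.elim (fun h => h.2) (fun h => absurd h.1 hcol)
  have hfromw : ∀ y, K.Adj w y → φ y = φ u := fun y hy =>
    hy.2.elim (fun h => absurd h.1.symm hcol) (fun h => h.2)
  have hn0 : 0 < n := by
    rcases Nat.eq_zero_or_pos n with h0 | h0
    · exact absurd (hx0.symm.trans (h0 ▸ hxn)) hne
    · exact h0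
  -- no vertex of the path has a neighbour in the chain besides its predecessor and successor
  have hmain : ∀ i, i < n → ∀ y, K.Adj (x i) y → y = x (i + 1) ∨ (0 < i ∧ y = x (i - 1)) := by
    intro i
    induction i using Nat.strong_induction_on with
    | _ i ih =>
      intro hi y hy
      by_contra! hcon
      obtain ⟨hy1, hy2⟩ := hcon
      have hxi := hadj i hi
      rcases i with _ | _ | i
      · rw [hx0] at hy hxi
        exact hy1 (hend u w hu hw hne huw _ _ hy.1 (hfromu y hy) hxi.1 (hfromu _ hxi))
      · have hx1 := hadj 0 (by omega)
        simp only [zero_add] at *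
        have hyu : y ≠ u := hx0 ▸ hy2 one_pos
        rw [hx0] at hx1
        have hc1 := hfromu _ hx1
        have hcy : ∀ z, K.Adj (x 1) z → φ z = φ u := fun z hz => hsame _ _ _ hz hx1.symm
        refine false_of_chair hG hy.1 hxi.1 hx1.1.symm hu.1.symm (hnonadj _ _ _ hy hxi)
          (hnonadj _ _ _ hy hx1.symm) (hnonadj _ _ _ hxi hx1.symm) ?_ ?_ ?_ hy1
        · intro ha
          exact huw (hw.2 _ ha hc1 ▸ hx1.1)
        · exact fun ha => hyu (hu.2 _ ha (hcy _ hy))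
        · intro ha
          have := hinj _ 0 (by omega) (by omega) ((hu.2 _ ha (hcy _ hxi)).trans hx0.symm)
          omega
      · have hd := hadj (i + 1) (by omega)
        have he := hadj i (by omega)
        have hy2' := hy2 (by omega)
        simp only [Nat.add_sub_cancel] at hy2'
        have hcole : φ (x i) = φ (x (i + 1 + 1)) := hsame _ _ _ he.symm hd
        refine false_of_chair hG hy.1 hxi.1 hd.1.symm he.1.symm (hnonadj _ _ _ hy hxi)
          (hnonadj _ _ _ hy hd.symm) (hnonadj _ _ _ hxi hd.symm)
          (hnonadj _ _ _ he.symm hd) ?_ ?_ hy1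
        · intro ha
          have hKa := hKof _ _ _ hy hcole ha
          rcases ih i (by omega) (by omega) y hKa with h1 | ⟨h1, h2⟩
          · exact hy2' h1
          · have hK' := hy.symm
            rw [h2] at hK'
            rcases ih (i - 1) (by omega) (by omega) _ hK' with h3 | ⟨h3, h4⟩
            · have := hinj _ _ (by omega) (by omega) h3; omega
            · have := hinj _ _ (by omega) (by omega) h4; omega
        · intro ha
          have hKa := hKof _ _ _ hxi hcole ha
          rcases ih i (by omega) (by omega) _ hKa with h1 | ⟨h1, h2⟩
          · have := hinj _ _ (by omega) (by omega) h1; omega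
          · have := hinj _ _ (by omega) (by omega) h2; omega
  have hclosed : ∀ z, K.Reachable u z → ∃ i, i ≤ n ∧ x i = z := by
    intro z hz
    rw [SimpleGraph.reachable_iff_reflTransGen] at hz
    induction hz with
    | refl => exact ⟨0, Nat.zero_le _, hx0⟩
    | @tail b c _ hbc ih =>
      obtain ⟨i, hi, rfl⟩ := ih
      rcases hi.lt_or_eq with hi | rfl
      · rcases hmain i hi c hbc with h1 | ⟨-, h1⟩
        · exact ⟨i + 1, hi, h1.symm⟩
        · exact ⟨i - 1, by omega, h1.symm⟩
      · have hl := (hadj (n - 1) (by omega)).symm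
        rw [Nat.sub_add_cancel hn0, hxn] at hl
        rw [hxn] at hbc
        exact ⟨n - 1, by omega, hend w u hw hu hne.symm (fun ha => huw ha.symm) _ _ hl.1
          (hfromw _ hl) hbc.1 (hfromw _ hbc)⟩
  obtain ⟨i, hi, rfl⟩ := hclosed s hs
  have hi0 : i ≠ 0 := by rintro rfl; exact hsu hx0
  have hin : i ≠ n := by rintro rfl; exact hsw hxn
  have hl := hadj (i - 1) (by omega)
  rw [Nat.sub_add_cancel (by omega)] at hl
  refine ⟨x (i - 1), x (i + 1), ?_, hl.symm, hadj i (by omega)⟩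
  intro he
  have := hinj _ _ (by omega) (by omega) he
  omega

end

section

variable {V : Type*} [Fintype V] [DecidableEq V] {G : SimpleGraph V} [DecidableRel G.Adj] {k : ℕ}
  {φ : V → Option (Fin k)} {v : V}

/-! ### Redundant neighbours and greedy extension -/

/-- A set `R` of neighbours of `z` is redundant if it adds nothing to the colours seen by the
neighbours of `z` outside `R`. If fewer than `k` neighbours remain, some colour is free at `z`. -/
lemma exists_color_of_redundant (ψ : V → Option (Fin k)) (z : V) (R : Finset V)
    (hcard : #(G.neighborFinset z) < k + #R)
    (hR : ∀ r ∈ R, G.Adj z r ∧ (ψ r = none ∨ ∃ r', G.Adj z r' ∧ r' ∉ R ∧ ψ r' = ψ r)) :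
    ∃ c, ∀ y, G.Adj z y → ψ y ≠ some c := by
  have hsub : R ⊆ G.neighborFinset z := fun r hr =>
    (G.mem_neighborFinset z r).2 (hR r hr).1
  have h1 : #((G.neighborFinset z \ R).image ψ) < #((univ : Finset (Fin k)).image some) := by
    rw [card_image_of_injective _ (Option.some_injective _), card_univ, Fintype.card_fin]
    refine lt_of_le_of_lt card_image_le ?_
    have := card_sdiff_add_card_eq_card hsub
    omega
  obtain ⟨o, ho, ho'⟩ := exists_mem_notMem_of_card_lt_card h1
  obtain ⟨c, -, rfl⟩ := mem_image.1 ho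
  have key : ∀ y, G.Adj z y → y ∉ R → ψ y ≠ some c := fun y hy hyR he =>
    ho' (mem_image.2 ⟨y, mem_sdiff.2 ⟨(G.mem_neighborFinset z y).2 hy, hyR⟩, he⟩)
  refine ⟨c, fun y hy he => ?_⟩
  by_cases hyR : y ∈ R
  · rcases (hR y hyR).2 with h2 | ⟨r', h2, h3, h4⟩
    · simp [h2] at he
    · exact key r' h2 h3 (h4.trans he)
  · exact key y hy hyR he

/-- If every `z ∈ T` has a redundant set that is witnessed outside `T`, then `T` can be coloured
greedily, in any order. -/
lemma IsPartialColoring.exists_extend (T : Finset V) {ψ : V → Option (Fin k)}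
    (hψ : IsPartialColoring G ψ)
    (hT : ∀ z ∈ T, ∃ R : Finset V, #(G.neighborFinset z) < k + #R ∧ ∀ r ∈ R, r ∉ T ∧ G.Adj z r ∧
      (ψ r = none ∨ ∃ r', G.Adj z r' ∧ r' ∉ R ∧ r' ∉ T ∧ ψ r' = ψ r)) :
    ∃ ψ' : V → Option (Fin k), IsPartialColoring G ψ' ∧ (∀ y, y ∉ T → ψ' y = ψ y) ∧
      ∀ z ∈ T, ψ' z ≠ none := by
  induction T using Finset.induction_on generalizing ψ with
  | empty => exact ⟨ψ, hψ, fun _ _ => rfl, by simp⟩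
  | @insert z T hz ih =>
    obtain ⟨R, hcard, hR⟩ := hT z (mem_insert_self z T)
    obtain ⟨c, hc⟩ := exists_color_of_redundant ψ z R hcard (fun r hr =>
      ⟨(hR r hr).2.1, (hR r hr).2.2.imp id fun ⟨r', h1, h2, _, h3⟩ => ⟨r', h1, h2, h3⟩⟩)
    have hpart : IsPartialColoring G (Function.update ψ z (some c)) := by
      intro x y hxy d hx hy
      by_cases hxz : x = z
      · subst hxz
        rw [Function.update_self] at hx
        rw [Function.update_of_ne hxy.ne'] at hy
        exact hc y hxy (hy.trans hx.symm)
      · rw [Function.update_of_ne hxz] at hx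
        by_cases hyz : y = z
        · subst hyz
          rw [Function.update_self] at hy
          exact hc x hxy.symm (hx.trans hy.symm)
        · rw [Function.update_of_ne hyz] at hy
          exact hψ x y hxy d hx hy
    have hup : ∀ y, y ∉ insert z T → Function.update ψ z (some c) y = ψ y := fun y hy =>
      Function.update_of_ne (by rintro rfl; exact hy (mem_insert_self _ _)) _ _
    obtain ⟨ψ', h1, h2, h3⟩ := ih hpart (by
      intro y hy
      obtain ⟨R', hcard', hR'⟩ := hT y (mem_insert_of_mem hy)
      refine ⟨R', hcard', fun r hr => ?_⟩
      obtain ⟨a1, a2, a3⟩ := hR' r hr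
      refine ⟨fun h => a1 (mem_insert_of_mem h), a2, ?_⟩
      rw [hup r a1]
      refine a3.imp id ?_
      rintro ⟨r', b1, b2, b3, b4⟩
      exact ⟨r', b1, b2, fun h => b3 (mem_insert_of_mem h), by rw [hup r' b3, b4]⟩)
    refine ⟨ψ', h1, fun y hy => ?_, fun y hy => ?_⟩
    · rw [h2 y (fun h => hy (mem_insert_of_mem h)), hup y hy]
    · rcases mem_insert.1 hy with rfl | hy
      · rw [h2 y hz, Function.update_self]
        simp
      · exact h3 y hy

/-- At most one colour is repeated around the uncoloured vertex. -/
lemma IsNearColoring.not_two_redundant (hN : ¬ G.Colorable k)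
    (hD : ∀ x, #(G.neighborFinset x) ≤ k + 1) (h : IsNearColoring G φ v) {x y x' y' : V}
    (hx : G.Adj v x) (hy : G.Adj v y) (hxy : x ≠ y) (hx' : G.Adj v x') (hxx : x' ≠ x)
    (hxy' : x' ≠ y) (hcx : φ x' = φ x) (hy' : G.Adj v y') (hyx : y' ≠ x) (hyy : y' ≠ y)
    (hcy : φ y' = φ y) : False := by
  obtain ⟨c, hc⟩ := exists_color_of_redundant (G := G) φ v {x, y}
    (by rw [card_pair hxy]; have := hD v; omega) (by
      intro r hr
      rcases mem_insert.1 hr with rfl | hr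
      · exact ⟨hx, Or.inr ⟨x', hx', by simp [hxx, hxy'], hcx⟩⟩
      · rw [mem_singleton] at hr
        subst hr
        exact ⟨hy, Or.inr ⟨y', hy', by simp [hyx, hyy], hcy⟩⟩)
  obtain ⟨u, hu, hu'⟩ := h.exists_adj_eq hN c
  exact hc u hu hu'

/-! ### Non-neighbours among the uniquely coloured neighbours -/

/-- The step that replaces Vizing's fan argument. Let `s`, `t` be the neighbours of `a`, `b` with
the colour of a common non-neighbour `w`. If `s ≠ t` and the colour of `b` were unique at `a`, then
after the uncoloured vertex moves to `a`, the chain through `s` and `b` would be a path with ends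
`s` and `b`, while before the move it is a path with ends `w` and `b`. -/
lemma IsNearColoring.eq_or_repeated (hG : IsChairFree G) (hN : ¬ G.Colorable k)
    (h : IsNearColoring G φ v) {w a b s t : V} (hw : IsSole G φ v w) (ha : IsSole G φ v a)
    (hb : IsSole G φ v b) (haw : ¬ G.Adj a w) (hbw : ¬ G.Adj b w) (hnaw : a ≠ w) (hnbw : b ≠ w)
    (hab : a ≠ b) (has : G.Adj a s) (hs : φ s = φ w) (hs' : ∀ x, G.Adj a x → φ x = φ w → x = s)
    (ht' : ∀ x, G.Adj b x → φ x = φ w → x = t) (hst : s ≠ t) :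
    G.Adj a b ∧ ∃ y, G.Adj a y ∧ y ≠ b ∧ φ y = φ b := by
  have hvs : ¬ G.Adj v s := fun hv => haw (hw.2 s hv hs ▸ has)
  have hbs : ¬ G.Adj b s := fun hb => hst (ht' s hb hs)
  have hadj : G.Adj a b := by
    by_contra hadj
    exact false_of_chair hG hb.1 hw.1 ha.1 has hbw (fun h => hadj h.symm) (fun h => haw h.symm)
      (fun h => hvs h.symm) (fun h => hbs h.symm) (fun ha => h.proper _ _ ha hs) hnbw
  refine ⟨hadj, ?_⟩
  by_contra! hcon
  have hcab := ha.ne_color hb hab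
  have hcaw := ha.ne_color hw hnaw
  have hcbw := hb.ne_color hw hnbw
  have hφv : φ v = none := (h.none_iff v).2 rfl
  have hsv : s ≠ v := by
    rintro rfl
    exact h.ne_none hw.1.ne' (hs.symm.trans hφv)
  have hsb : s ≠ b := by
    rintro rfl
    exact hcbw hs
  set φ' := φ ∘ Equiv.swap v a with hφ'
  have h' : IsNearColoring G φ' a := h.shift ha
  have heq : ∀ x, x ≠ v → x ≠ a → φ' x = φ x := fun x h1 h2 =>
    comp_swap_apply_of_ne φ h1 h2
  have hφ'v : φ' v = φ a := by simp [hφ']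
  have hφ'a : φ' a = none := by simp [hφ', hφv]
  have hφ'b : φ' b = φ b := heq b hb.1.ne' hab.symm
  have hφ's : φ' s = φ w := (heq s hsv has.ne').trans hs
  have hb' : IsSole G φ' a b := by
    refine ⟨hadj, fun x hx hxb => ?_⟩
    rw [hφ'b] at hxb
    by_cases hxv : x = v
    · subst hxv
      exact absurd (hφ'v.symm.trans hxb) hcab
    · by_contra hne
      exact hcon x hx hne ((heq x hxv hx.ne').symm.trans hxb)
  have hs'' : IsSole G φ' a s := by
    refine ⟨has, fun x hx hxs => ?_⟩
    rw [hφ's] at hxs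
    by_cases hxv : x = v
    · subst hxv
      exact absurd (hφ'v.symm.trans hxs) hcaw
    · exact hs' x hx ((heq x hxv hx.ne').symm.trans hxs)
  -- neither `v` nor `a` lies on a chain in the colours of `w` and `b`, so the move does not alter it
  have hiff : ∀ x, ∀ c, c = φ w ∨ c = φ b → (φ' x = c ↔ φ x = c) := by
    intro x c hc
    have hc0 : c ≠ none := by
      rcases hc with rfl | rfl
      · exact h.ne_none hw.1.ne'
      · exact h.ne_none hb.1.ne'
    have hca : φ a ≠ c := by
      rcases hc with rfl | rfl <;> assumption
    by_cases hxv : x = v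
    · subst hxv
      rw [hφ'v, hφv]
      exact ⟨fun h => absurd h hca, fun h => absurd h.symm hc0⟩
    by_cases hxa : x = a
    · subst hxa
      rw [hφ'a]
      exact ⟨fun h => absurd h.symm hc0, fun h => absurd h hca⟩
    · rw [heq x hxv hxa]
  have hkempe : kempe G φ' (φ' s) (φ' b) = kempe G φ (φ w) (φ b) := by
    ext x y
    simp only [kempe, hφ's, hφ'b]
    rw [hiff x _ (Or.inl rfl), hiff x _ (Or.inr rfl), hiff y _ (Or.inl rfl), hiff y _ (Or.inr rfl)]
  have hreach := h'.reachable_kempe hN hs'' hb'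
  rw [hkempe] at hreach
  obtain ⟨y, z, hyz, hy, hz⟩ := h.exists_two_kempe_adj hG hN hw hb hnbw.symm
    (fun h => hbw h.symm) ((h.reachable_kempe hN hw hb).trans hreach.symm)
    (fun he => haw (he ▸ has)) hsb
  obtain ⟨r, -, -, hr⟩ := h'.existsUnique_adj_eq hG hN hs'' hb' hsb (fun h => hbs h.symm)
  have hcolor : ∀ x, (kempe G φ (φ w) (φ b)).Adj s x → φ' x = φ' b := by
    rintro x ⟨-, hx⟩
    rw [hφ'b, hiff x _ (Or.inr rfl)]
    exact hx.elim (fun h => h.2) (fun h => absurd (hs.symm.trans h.1).symm hcbw)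
  exact hyz ((hr y hy.1 (hcolor y hy)).trans (hr z hz.1 (hcolor z hz)).symm)

/-- A uniquely coloured neighbour `w` of `v` has at most two non-neighbours among the uniquely
coloured neighbours of `v`. With three of them, `u₁`, `u₂`, `u₃`, the chains from all three to `w`
pass through the same second vertex `s`, and three colours would be repeated around `s`. -/
lemma IsNearColoring.not_three_nonadj (hG : IsChairFree G) (hN : ¬ G.Colorable k)
    (hD : ∀ x, #(G.neighborFinset x) ≤ k + 1) (h : IsNearColoring G φ v) {w u₁ u₂ u₃ : V}
    (hw : IsSole G φ v w) (h₁ : IsSole G φ v u₁) (h₂ : IsSole G φ v u₂) (h₃ : IsSole G φ v u₃)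
    (h₁₂ : u₁ ≠ u₂) (h₁₃ : u₁ ≠ u₃) (h₂₃ : u₂ ≠ u₃) (hn₁ : u₁ ≠ w) (hn₂ : u₂ ≠ w) (hn₃ : u₃ ≠ w)
    (ha₁ : ¬ G.Adj u₁ w) (ha₂ : ¬ G.Adj u₂ w) (ha₃ : ¬ G.Adj u₃ w) : False := by
  obtain ⟨s₁, hs₁, hc₁, hq₁⟩ := h.existsUnique_adj_eq hG hN h₁ hw hn₁ ha₁
  obtain ⟨s₂, hs₂, hc₂, hq₂⟩ := h.existsUnique_adj_eq hG hN h₂ hw hn₂ ha₂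
  obtain ⟨s₃, hs₃, hc₃, hq₃⟩ := h.existsUnique_adj_eq hG hN h₃ hw hn₃ ha₃
  -- two colours of the `u`'s cannot both be repeated around the third
  have key : ∀ a b c s t r, IsSole G φ v a → IsSole G φ v b → IsSole G φ v c → a ≠ b → a ≠ c →
      b ≠ c → a ≠ w → b ≠ w → c ≠ w → ¬ G.Adj a w → ¬ G.Adj b w → ¬ G.Adj c w →
      G.Adj a s → φ s = φ w → (∀ x, G.Adj a x → φ x = φ w → x = s) →
      (∀ x, G.Adj b x → φ x = φ w → x = t) → (∀ x, G.Adj c x → φ x = φ w → x = r) →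
      s = t ∨ s = r := by
    intro a b c s t r ha hb hc hab hac hbc hna hnb hnc haw hbw hcw has hs hqa hqb hqc
    by_contra! hcon
    obtain ⟨hab', y, hy, hyb, hyc⟩ :=
      h.eq_or_repeated hG hN hw ha hb haw hbw hna hnb hab has hs hqa hqb hcon.1
    obtain ⟨hac', z, hz, hzc, hzc'⟩ :=
      h.eq_or_repeated hG hN hw ha hc haw hcw hna hnc hac has hs hqa hqc hcon.2
    have hcolbc := hb.ne_color hc hbc
    have hφv : φ v = none := (h.none_iff v).2 rfl
    have hyv : y ≠ v := by
      rintro rfl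
      exact h.ne_none hb.1.ne' (hyc.symm.trans hφv)
    have hzv : z ≠ v := by
      rintro rfl
      exact h.ne_none hc.1.ne' (hzc'.symm.trans hφv)
    have heq : ∀ x, x ≠ v → x ≠ a → (φ ∘ Equiv.swap v a) x = φ x := fun x h1 h2 =>
      comp_swap_apply_of_ne φ h1 h2
    refine (h.shift ha).not_two_redundant hN hD hab' hac' hbc hy hyb ?_ ?_ hz ?_ hzc ?_
    · rintro rfl
      exact hcolbc hyc.symm
    · rw [heq y hyv hy.ne', heq b hb.1.ne' hab.symm, hyc]
    · rintro rfl
      exact hcolbc hzc'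
    · rw [heq z hzv hz.ne', heq c hc.1.ne' hac.symm, hzc']
  have k₁ := key _ _ _ s₁ s₂ s₃ h₁ h₂ h₃ h₁₂ h₁₃ h₂₃ hn₁ hn₂ hn₃ ha₁ ha₂ ha₃ hs₁ hc₁ hq₁ hq₂ hq₃
  have k₂ := key _ _ _ s₂ s₁ s₃ h₂ h₁ h₃ h₁₂.symm h₂₃ h₁₃ hn₂ hn₁ hn₃ ha₂ ha₁ ha₃ hs₂ hc₂ hq₂
    hq₁ hq₃
  have k₃ := key _ _ _ s₃ s₁ s₂ h₃ h₁ h₂ h₁₃.symm h₂₃.symm h₁₂ hn₃ hn₁ hn₂ ha₃ ha₁ ha₂ hs₃ hc₃ hq₃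
    hq₁ hq₂
  -- each of the three vertices equals one of the other two, so all three are equal
  have e₂ : s₂ = s₁ := by
    rcases k₂ with h | h
    · exact h
    · rcases k₁ with h' | h'
      · exact h'.symm
      · exact h.trans h'.symm
  have e₃ : s₃ = s₁ := by
    rcases k₃ with h | h
    · exact h
    · exact h.trans e₂
  subst e₂ e₃
  obtain ⟨y₂, hy₂, hyu₂, hyc₂⟩ := h.exists_second hN h₂ hw hn₂ ha₂ hs₂ hc₂ hq₂
  obtain ⟨y₃, hy₃, hyu₃, hyc₃⟩ := h.exists_second hN h₃ hw hn₃ ha₃ hs₃ hc₃ hq₃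
  have hvs : ∀ x, G.Adj s₃ x → x ≠ v := by
    rintro x hx rfl
    exact ha₁ (hw.2 _ hx.symm hc₁ ▸ hs₁)
  have heq : ∀ x, G.Adj s₃ x → x ≠ u₁ →
      ((φ ∘ Equiv.swap v u₁) ∘ Equiv.swap u₁ s₃) x = φ x := by
    intro x hx hxu
    rw [comp_swap_apply_of_ne _ hxu hx.ne',
      comp_swap_apply_of_ne φ (hvs x hx) hxu]
  have hcol₁₂ := h₁.ne_color h₂ h₁₂
  have hcol₁₃ := h₁.ne_color h₃ h₁₃
  have hcol₂₃ := h₂.ne_color h₃ h₂₃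
  have hy₂₁ : y₂ ≠ u₁ := by
    rintro rfl
    exact hcol₁₂ hyc₂
  have hy₃₁ : y₃ ≠ u₁ := by
    rintro rfl
    exact hcol₁₃ hyc₃
  -- with `s₃` uncoloured, the colours of `u₂` and `u₃` are both repeated around it
  refine (h.shift_shift h₁ hw hn₁ hs₁ hc₁ hq₁).not_two_redundant hN hD hs₂.symm hs₃.symm h₂₃ hy₂
    hyu₂ ?_ ?_ hy₃ ?_ hyu₃ ?_
  · rintro rfl
    exact hcol₂₃ hyc₂.symm
  · rw [heq _ hy₂ hy₂₁, heq _ hs₂.symm h₁₂.symm, hyc₂]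
  · rintro rfl
    exact hcol₂₃ hyc₃
  · rw [heq _ hy₃ hy₃₁, heq _ hs₃.symm h₁₃.symm, hyc₃]

end

section

variable {V : Type*} [Fintype V] {G : SimpleGraph V} {k : ℕ} {φ : V → Option (Fin k)} {v : V}

/-! ### The uniquely coloured neighbours form a clique -/

open Classical in
/-- The neighbours of `v` whose colour is unique at `v`. -/
noncomputable def soleSet (G : SimpleGraph V) (φ : V → Option (Fin k)) (v : V) : Finset V :=
  {u | IsSole G φ v u}

lemma mem_soleSet {u : V} : u ∈ soleSet G φ v ↔ IsSole G φ v u := by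
  simp [soleSet]

variable [DecidableEq V] [DecidableRel G.Adj]

/-- The closed neighbourhood of `v`. -/
def closedNbhd (G : SimpleGraph V) [DecidableRel G.Adj] (v : V) : Finset V :=
  insert v (G.neighborFinset v)

lemma mem_closedNbhd {u : V} : u ∈ closedNbhd G v ↔ u = v ∨ G.Adj v u := by
  simp [closedNbhd]

lemma card_add_card_sdiff_closedNbhd_le (hD : ∀ x, #(G.neighborFinset x) ≤ k + 1) {z : V}
    {S : Finset V} (hS : ∀ s ∈ S, G.Adj z s ∧ s ∈ closedNbhd G v) :
    #S + #(G.neighborFinset z \ closedNbhd G v) ≤ k + 1 := by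
  have hdis : Disjoint S (G.neighborFinset z \ closedNbhd G v) :=
    disjoint_left.2 fun s hs hs' => (mem_sdiff.1 hs').2 (hS s hs).2
  rw [← card_union_of_disjoint hdis]
  refine (card_le_card (union_subset (fun s hs => ?_) sdiff_subset)).trans (hD z)
  exact (G.mem_neighborFinset z s).2 (hS s hs).1

lemma exists_color_notMem (F : Finset (Option (Fin k))) (hF : #F < k) :
    ∃ c : Fin k, some c ∉ F := by
  have h1 : #F < #((univ : Finset (Fin k)).image some) := by
    rwa [card_image_of_injective _ (Option.some_injective _), card_univ, Fintype.card_fin]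
  obtain ⟨o, ho, ho'⟩ := exists_mem_notMem_of_card_lt_card h1
  obtain ⟨c, -, rfl⟩ := mem_image.1 ho
  exact ⟨c, ho'⟩

/-- Either all neighbours of `v` are uniquely coloured, or exactly two of them share a colour. -/
lemma IsNearColoring.sole_or_pair (hN : ¬ G.Colorable k)
    (hD : ∀ x, #(G.neighborFinset x) ≤ k + 1) (h : IsNearColoring G φ v) :
    (G.neighborFinset v = soleSet G φ v ∧ #(G.neighborFinset v) = k) ∨
      ∃ p q, p ≠ q ∧ φ p = φ q ∧ p ∉ soleSet G φ v ∧ q ∉ soleSet G φ v ∧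
        G.neighborFinset v = insert p (insert q (soleSet G φ v)) ∧
        #(soleSet G φ v) + 1 = k := by
  by_cases hall : ∀ u, G.Adj v u → IsSole G φ v u
  · left
    refine ⟨?_, le_antisymm ?_ ?_⟩
    · ext u
      rw [SimpleGraph.mem_neighborFinset, mem_soleSet]
      exact ⟨hall u, fun h => h.1⟩
    · have : #((univ : Finset (Fin k)).image some) = k := by
        rw [card_image_of_injective _ (Option.some_injective _), card_univ, Fintype.card_fin]
      rw [← this]
      refine card_le_card_of_injOn φ (fun u hu => ?_) (fun x hx y hy hxy => ?_)
      · rw [mem_coe, SimpleGraph.mem_neighborFinset] at hu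
        obtain ⟨c, hc⟩ := Option.ne_none_iff_exists'.1 (h.ne_none hu.ne')
        rw [hc]
        simp
      · rw [mem_coe, SimpleGraph.mem_neighborFinset] at hx hy
        exact (hall y hy).2 x hx hxy
    · by_contra! hlt
      obtain ⟨c, hc⟩ := exists_color_of_redundant (G := G) φ v ∅ (by simpa using hlt) (by simp)
      obtain ⟨u, hu, hu'⟩ := h.exists_adj_eq hN c
      exact hc u hu hu'
  · right
    push Not at hall
    obtain ⟨p, hp, hps⟩ := hall
    have : ∃ q, G.Adj v q ∧ φ q = φ p ∧ q ≠ p := by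
      by_contra! hcon
      exact hps ⟨hp, hcon⟩
    obtain ⟨q, hq, hqp, hne⟩ := this
    have hqs : ¬ IsSole G φ v q := fun hs => hne (hs.2 p hp hqp.symm).symm
    have hrest : ∀ u, G.Adj v u → u ≠ p → u ≠ q → IsSole G φ v u := by
      intro u hu hup huq
      refine ⟨hu, fun x hx hxu => ?_⟩
      by_contra hxne
      by_cases hxp : x = p
      · subst hxp
        exact h.not_two_redundant hN hD hu hp hup hq huq.symm hne (hqp.trans hxu) hq huq.symm hne
          hqp
      · exact h.not_two_redundant hN hD hu hp hup hx hxne hxp hxu hq huq.symm hne hqp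
    have heq : G.neighborFinset v = insert p (insert q (soleSet G φ v)) := by
      ext u
      rw [SimpleGraph.mem_neighborFinset, mem_insert, mem_insert, mem_soleSet]
      constructor
      · intro hu
        by_cases h1 : u = p
        · exact Or.inl h1
        by_cases h2 : u = q
        · exact Or.inr (Or.inl h2)
        exact Or.inr (Or.inr (hrest u hu h1 h2))
      · rintro (rfl | rfl | hu)
        · exact hp
        · exact hq
        · exact hu.1
    have hpU : p ∉ soleSet G φ v := fun hm => hps (mem_soleSet.1 hm)
    have hqU : q ∉ soleSet G φ v := fun hm => hqs (mem_soleSet.1 hm)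
    refine ⟨p, q, hne.symm, hqp.symm, hpU, hqU, heq, ?_⟩
    have hcard : #(G.neighborFinset v) = #(soleSet G φ v) + 2 := by
      rw [heq, card_insert_of_notMem, card_insert_of_notMem hqU]
      rw [mem_insert]
      exact fun hm => hm.elim hne.symm hpU
    have h1 := hD v
    have h2 : k + 1 ≤ #(G.neighborFinset v) := by
      by_contra! hlt
      obtain ⟨c, hc⟩ := exists_color_of_redundant (G := G) φ v {p} (by simpa using hlt) (by
        intro r hr
        rw [mem_singleton] at hr
        subst hr
        exact ⟨hp, Or.inr ⟨q, hq, by simpa using hne, hqp⟩⟩)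
      obtain ⟨u, hu, hu'⟩ := h.exists_adj_eq hN c
      exact hc u hu hu'
    omega

/-- Otherwise `v`, `p`, `q`, `u` and a neighbour of `u` with the colour of `p` form a chair. -/
lemma IsNearColoring.adj_or_adj (hG : IsChairFree G) (hN : ¬ G.Colorable k)
    (h : IsNearColoring G φ v) {p q u : V} (hpq : p ≠ q) (hcol : φ p = φ q)
    (hnbr : G.neighborFinset v = insert p (insert q (soleSet G φ v))) (hu : u ∈ soleSet G φ v) :
    G.Adj u p ∨ G.Adj u q := by
  by_contra! hcon
  obtain ⟨hup, huq⟩ := hcon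
  have hu' := mem_soleSet.1 hu
  have hp : G.Adj v p := by rw [← SimpleGraph.mem_neighborFinset, hnbr]; simp
  have hq : G.Adj v q := by rw [← SimpleGraph.mem_neighborFinset, hnbr]; simp
  have hpu : φ p ≠ φ u := fun he => hpq ((hu'.2 p hp he).trans (hu'.2 q hq (hcol ▸ he)).symm)
  obtain ⟨s, hus, hs⟩ := h.exists_adj_eq_of_isSole hN hu' hp.ne' hpu
  have hsv : ¬ G.Adj v s := by
    intro hvs
    rw [← SimpleGraph.mem_neighborFinset, hnbr, mem_insert, mem_insert] at hvs
    rcases hvs with rfl | rfl | hvs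
    · exact hup hus
    · exact huq hus
    · have := (mem_soleSet.1 hvs).2 p hp hs.symm
      exact hup (this ▸ hus)
  exact false_of_chair hG hp hq hu'.1 hus (fun ha => h.proper _ _ ha hcol) (fun ha => hup ha.symm)
    (fun ha => huq ha.symm) (fun ha => hsv ha.symm) (fun ha => h.proper _ _ ha hs)
    (fun ha => h.proper _ _ ha (hs.trans hcol)) hpq

lemma IsNearColoring.card_nonadj_le (hG : IsChairFree G) (hN : ¬ G.Colorable k)
    (hD : ∀ x, #(G.neighborFinset x) ≤ k + 1) (h : IsNearColoring G φ v) {w : V}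
    (hw : w ∈ soleSet G φ v) : #{u ∈ soleSet G φ v | ¬ G.Adj u w} ≤ 3 := by
  by_contra! hlt
  have hmem : w ∈ {u ∈ soleSet G φ v | ¬ G.Adj u w} := mem_filter.2 ⟨hw, G.loopless.irrefl w⟩
  have h2 : 2 < #(({u ∈ soleSet G φ v | ¬ G.Adj u w}).erase w) := by
    rw [card_erase_of_mem hmem]
    omega
  obtain ⟨a, b, c, ha, hb, hc, hab, hac, hbc⟩ := two_lt_card_iff.1 h2
  simp only [mem_erase, mem_filter, mem_soleSet] at ha hb hc
  exact h.not_three_nonadj hG hN hD (mem_soleSet.1 hw) ha.2.1 hb.2.1 hc.2.1 hab hac hbc ha.1 hb.1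
    hc.1 ha.2.2 hb.2.2 hc.2.2

/-- A uniquely coloured neighbour of `v` misses few vertices of `N(v)`, hence has at most three
neighbours outside the closed neighbourhood of `v`. -/
lemma IsNearColoring.card_sdiff_le (hG : IsChairFree G) (hN : ¬ G.Colorable k)
    (hD : ∀ x, #(G.neighborFinset x) ≤ k + 1) (h : IsNearColoring G φ v) {w : V}
    (hw : w ∈ soleSet G φ v) : #(G.neighborFinset w \ closedNbhd G v) ≤ 3 := by
  have hnn := h.card_nonadj_le hG hN hD hw
  have hvw := (mem_soleSet.1 hw).1
  have hmain : k ≤ #(G.neighborFinset v ∩ G.neighborFinset w) + 3 := by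
    have hsplit := card_sdiff_add_card_inter (G.neighborFinset v) (G.neighborFinset w)
    rcases h.sole_or_pair hN hD with ⟨heq, hcard⟩ | ⟨p, q, hpq, hcol, hpU, hqU, heq, hcard⟩
    · have hsub : G.neighborFinset v \ G.neighborFinset w ⊆
          {u ∈ soleSet G φ v | ¬ G.Adj u w} := by
        intro u hu
        rw [mem_sdiff, heq, SimpleGraph.mem_neighborFinset] at hu
        exact mem_filter.2 ⟨hu.1, fun ha => hu.2 ha.symm⟩
      have := card_le_card hsub
      omega
    · have hN' : #(G.neighborFinset v) = #(soleSet G φ v) + 2 := by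
        rw [heq, card_insert_of_notMem, card_insert_of_notMem hqU]
        rw [mem_insert]
        exact fun hm => hm.elim hpq hpU
      have hsub : ∃ r, G.neighborFinset v \ G.neighborFinset w ⊆
          insert r {u ∈ soleSet G φ v | ¬ G.Adj u w} := by
        rcases h.adj_or_adj hG hN hpq hcol heq hw with ha | ha
        · refine ⟨q, fun u hu => ?_⟩
          rw [mem_sdiff, heq, SimpleGraph.mem_neighborFinset, mem_insert, mem_insert] at hu
          rw [mem_insert, mem_filter]
          rcases hu with ⟨rfl | rfl | h1, h2⟩
          · exact absurd ha h2
          · exact Or.inl rfl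
          · exact Or.inr ⟨h1, fun ha => h2 ha.symm⟩
        · refine ⟨p, fun u hu => ?_⟩
          rw [mem_sdiff, heq, SimpleGraph.mem_neighborFinset, mem_insert, mem_insert] at hu
          rw [mem_insert, mem_filter]
          rcases hu with ⟨rfl | rfl | h1, h2⟩
          · exact Or.inl rfl
          · exact absurd ha h2
          · exact Or.inr ⟨h1, fun ha => h2 ha.symm⟩
      obtain ⟨r, hr⟩ := hsub
      have h1 := card_le_card hr
      have h2 := card_insert_le r {u ∈ soleSet G φ v | ¬ G.Adj u w}
      omega
  have hle := card_add_card_sdiff_closedNbhd_le (v := v) hD (z := w)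
    (S := insert v (G.neighborFinset v ∩ G.neighborFinset w)) (by
      intro s hs
      rw [mem_insert, mem_inter, SimpleGraph.mem_neighborFinset,
        SimpleGraph.mem_neighborFinset] at hs
      rw [mem_closedNbhd]
      rcases hs with rfl | hs
      · exact ⟨hvw.symm, Or.inl rfl⟩
      · exact ⟨hs.2, Or.inr hs.1⟩)
  rw [card_insert_of_notMem (by simp)] at hle
  omega

/-- For two non-adjacent uniquely coloured neighbours `x`, `y` of `v`, the sets of neighbours
missed by `x`, by `y` and by any third vertex that misses one of them overlap, and leave a common
neighbour. -/
lemma IsNearColoring.exists_common_adj (hG : IsChairFree G) (hN : ¬ G.Colorable k)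
    (hD : ∀ x, #(G.neighborFinset x) ≤ k + 1) (hk : 8 ≤ k) (h : IsNearColoring G φ v)
    {x y z : V} (hx : x ∈ soleSet G φ v) (hy : y ∈ soleSet G φ v) (hz : z ∈ soleSet G φ v)
    (hxy : ¬ G.Adj x y) (hne : x ≠ y) (hzx : z ≠ x) (hzy : z ≠ y)
    (hbad : ¬ (G.Adj z x ∧ G.Adj z y)) :
    ∃ g ∈ soleSet G φ v, G.Adj g x ∧ G.Adj g y ∧ G.Adj g z := by
  have hU : 7 ≤ #(soleSet G φ v) := by
    rcases h.sole_or_pair hN hD with ⟨heq, hcard⟩ | ⟨p, q, -, -, -, -, -, hcard⟩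
    · rw [heq] at hcard
      omega
    · omega
  set U := soleSet G φ v
  have irr := G.loopless.irrefl
  have c1 := h.card_nonadj_le hG hN hD hx
  have c2 := h.card_nonadj_le hG hN hD hy
  have c3 := h.card_nonadj_le hG hN hD hz
  set A : Finset V := {u ∈ U | ¬ G.Adj u x} with hA
  set B : Finset V := {u ∈ U | ¬ G.Adj u y} with hB
  set C : Finset V := {u ∈ U | ¬ G.Adj u z} with hC
  have i1 : ({x, y} : Finset V) ⊆ A ∩ B := by
    intro u hu
    rw [mem_insert, mem_singleton] at hu
    simp only [A, B, mem_inter, mem_filter]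
    rcases hu with rfl | rfl
    · exact ⟨⟨hx, irr _⟩, ⟨hx, hxy⟩⟩
    · exact ⟨⟨hy, fun ha => hxy ha.symm⟩, ⟨hy, irr _⟩⟩
  have i2 : ∃ w, w ≠ z ∧ ({w, z} : Finset V) ⊆ (A ∪ B) ∩ C := by
    have hzAB : z ∈ A ∪ B := by
      simp only [A, B, mem_union, mem_filter]
      tauto
    have hzC : z ∈ C := mem_filter.2 ⟨hz, irr _⟩
    have hxA : x ∈ A := mem_filter.2 ⟨hx, irr _⟩
    have hyB : y ∈ B := mem_filter.2 ⟨hy, irr _⟩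
    by_cases hzx' : G.Adj z x
    · refine ⟨y, hzy.symm, fun u hu => ?_⟩
      rw [mem_insert, mem_singleton] at hu
      rcases hu with rfl | rfl
      · exact mem_inter.2 ⟨mem_union_right _ hyB,
          mem_filter.2 ⟨hy, fun ha => hbad ⟨hzx', ha.symm⟩⟩⟩
      · exact mem_inter.2 ⟨hzAB, hzC⟩
    · refine ⟨x, hzx.symm, fun u hu => ?_⟩
      rw [mem_insert, mem_singleton] at hu
      rcases hu with rfl | rfl
      · exact mem_inter.2 ⟨mem_union_left _ hxA, mem_filter.2 ⟨hx, fun ha => hzx' ha.symm⟩⟩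
      · exact mem_inter.2 ⟨hzAB, hzC⟩
  obtain ⟨w, hwz, i2⟩ := i2
  have d1 := card_le_card i1
  have d2 := card_le_card i2
  rw [card_pair hne] at d1
  rw [card_pair hwz] at d2
  have e1 := card_union_add_card_inter A B
  have e2 := card_union_add_card_inter (A ∪ B) C
  obtain ⟨g, hg, hg'⟩ := exists_mem_notMem_of_card_lt_card
    (show #((A ∪ B) ∪ C) < #U by omega)
  simp only [A, B, C, mem_union, mem_filter, not_or, not_and, not_not] at hg'
  exact ⟨g, hg, hg'.1.1 hg, hg'.1.2 hg, hg'.2 hg⟩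

/-- Two non-adjacent uniquely coloured neighbours `x`, `y` of `v` would have a common free colour
once the closed neighbourhood of `v` is uncoloured, since each has at most three neighbours outside
it and `7 < k`. With that colour on both, the rest of the neighbourhood can be coloured greedily:
first the vertices that miss `x` or `y`, then the common neighbours of `x` and `y`, and `v` last. -/
lemma IsNearColoring.sole_adj (hG : IsChairFree G) (hN : ¬ G.Colorable k)
    (hD : ∀ x, #(G.neighborFinset x) ≤ k + 1) (hk : 8 ≤ k) (h : IsNearColoring G φ v)
    {x y : V} (hx : x ∈ soleSet G φ v) (hy : y ∈ soleSet G φ v) (hne : x ≠ y) : G.Adj x y := by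
  classical
  by_contra hxy
  have hxs := mem_soleSet.1 hx
  have hys := mem_soleSet.1 hy
  -- the repeated colour at `v`, if there is one
  have hdcol : ∃ d : Option (Fin k), ∀ z, G.Adj v z → z ∉ soleSet G φ v → φ z = d := by
    rcases h.sole_or_pair hN hD with ⟨heq, -⟩ | ⟨p, q, -, hcol, -, -, heq, -⟩
    · refine ⟨none, fun z hz hzU => absurd ?_ hzU⟩
      rwa [← heq, SimpleGraph.mem_neighborFinset]
    · refine ⟨φ p, fun z hz hzU => ?_⟩
      rw [← SimpleGraph.mem_neighborFinset, heq, mem_insert, mem_insert] at hz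
      rcases hz with rfl | rfl | hz
      · rfl
      · exact hcol.symm
      · exact absurd hz hzU
  obtain ⟨d, hd⟩ := hdcol
  obtain ⟨α, hα⟩ := exists_color_notMem
    (insert d ((G.neighborFinset x \ closedNbhd G v).image φ ∪
      (G.neighborFinset y \ closedNbhd G v).image φ)) (by
      have h1 := card_insert_le d ((G.neighborFinset x \ closedNbhd G v).image φ ∪
        (G.neighborFinset y \ closedNbhd G v).image φ)
      have h2 := card_union_le ((G.neighborFinset x \ closedNbhd G v).image φ)
        ((G.neighborFinset y \ closedNbhd G v).image φ)
      have h3 := card_image_le (s := G.neighborFinset x \ closedNbhd G v) (f := φ)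
      have h4 := card_image_le (s := G.neighborFinset y \ closedNbhd G v) (f := φ)
      have h5 := h.card_sdiff_le hG hN hD hx
      have h6 := h.card_sdiff_le hG hN hD hy
      omega)
  simp only [mem_insert, mem_union, mem_image, mem_sdiff, SimpleGraph.mem_neighborFinset,
    mem_closedNbhd, not_or, not_exists, not_and] at hα
  obtain ⟨hαd, hαx, hαy⟩ := hα
  let ψ : V → Option (Fin k) := fun z =>
    if z = x ∨ z = y then some α else if z = v ∨ z ∈ soleSet G φ v then none else φ z
  have hψxy : ∀ z, (z = x ∨ z = y) → ψ z = some α := fun z hz => if_pos hz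
  have hψnone : ∀ z, ¬ (z = x ∨ z = y) → (z = v ∨ z ∈ soleSet G φ v) → ψ z = none :=
    fun z h1 h2 => by simp only [ψ, if_neg h1, if_pos h2]
  have hψφ : ∀ z, ¬ (z = v ∨ z ∈ soleSet G φ v) → ψ z = φ z := by
    intro z h1
    have : ¬ (z = x ∨ z = y) := by
      rintro (rfl | rfl)
      · exact h1 (Or.inr hx)
      · exact h1 (Or.inr hy)
    simp only [ψ, if_neg h1, if_neg this]
  have hclash : ∀ a b, G.Adj a b → (a = x ∨ a = y) → ψ b ≠ some α := by
    intro a b hab ha hb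
    by_cases hbxy : b = x ∨ b = y
    · rcases ha with rfl | rfl <;> rcases hbxy with rfl | rfl
      · exact hab.ne rfl
      · exact hxy hab
      · exact hxy hab.symm
      · exact hab.ne rfl
    by_cases hbU : b = v ∨ b ∈ soleSet G φ v
    · rw [hψnone b hbxy hbU] at hb
      cases hb
    rw [hψφ b hbU] at hb
    push Not at hbU
    by_cases hvb : G.Adj v b
    · exact hαd (hb.symm.trans (hd b hvb hbU.2))
    · rcases ha with rfl | rfl
      · exact hαx b ⟨hab, hbU.1, hvb⟩ hb
      · exact hαy b ⟨hab, hbU.1, hvb⟩ hb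
  have hpart : IsPartialColoring G ψ := by
    intro a b hab c ha hb
    by_cases haxy : a = x ∨ a = y
    · exact hclash a b hab haxy (hb.trans (ha.symm.trans (hψxy a haxy)))
    by_cases hbxy : b = x ∨ b = y
    · exact hclash b a hab.symm hbxy (ha.trans (hb.symm.trans (hψxy b hbxy)))
    by_cases haU : a = v ∨ a ∈ soleSet G φ v
    · rw [hψnone a haxy haU] at ha
      cases ha
    by_cases hbU : b = v ∨ b ∈ soleSet G φ v
    · rw [hψnone b hbxy hbU] at hb
      cases hb
    rw [hψφ a haU] at ha
    rw [hψφ b hbU] at hb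
    exact h.proper a b hab (ha.trans hb.symm)
  have hvx : v ≠ x := hxs.1.ne
  have hvy : v ≠ y := hys.1.ne
  have hvU : v ∉ soleSet G φ v := fun hm => (mem_soleSet.1 hm).1.ne rfl
  have hψv : ψ v = none := hψnone v (by tauto) (Or.inl rfl)
  set T₁ : Finset V := {z ∈ soleSet G φ v | z ≠ x ∧ z ≠ y ∧ ¬ (G.Adj z x ∧ G.Adj z y)} with hT₁
  set T₂ : Finset V := {z ∈ soleSet G φ v | G.Adj z x ∧ G.Adj z y} with hT₂
  have hvT₁ : v ∉ T₁ := fun hm => hvU (mem_filter.1 hm).1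
  have hvT₂ : v ∉ T₂ := fun hm => hvU (mem_filter.1 hm).1
  have hxT₁ : x ∉ T₁ := fun hm => (mem_filter.1 hm).2.1 rfl
  have hyT₁ : y ∉ T₁ := fun hm => (mem_filter.1 hm).2.2.1 rfl
  have hxT₂ : x ∉ T₂ := fun hm => (mem_filter.1 hm).2.1.ne rfl
  have hyT₂ : y ∉ T₂ := fun hm => (mem_filter.1 hm).2.2.ne rfl
  -- a vertex of `T₁` has `v` and a neighbour in `T₂` still uncoloured
  obtain ⟨ψ₁, hp₁, he₁, hc₁⟩ := hpart.exists_extend T₁ (by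
    intro z hz
    obtain ⟨hzU, hzx, hzy, hbad⟩ := mem_filter.1 hz
    obtain ⟨g, hgU, hgx, hgy, hgz⟩ :=
      h.exists_common_adj hG hN hD hk hx hy hzU hxy hne hzx hzy hbad
    have hvg := (mem_soleSet.1 hgU).1
    refine ⟨{v, g}, ?_, ?_⟩
    · rw [card_pair hvg.ne]
      have := hD z
      omega
    · intro r hr
      rw [mem_insert, mem_singleton] at hr
      rcases hr with rfl | rfl
      · exact ⟨hvT₁, (mem_soleSet.1 hzU).1.symm, Or.inl hψv⟩
      · refine ⟨fun hm => (mem_filter.1 hm).2.2.2 ⟨hgx, hgy⟩, hgz.symm, Or.inl ?_⟩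
        refine hψnone _ ?_ (Or.inr hgU)
        rintro (rfl | rfl)
        · exact hgx.ne rfl
        · exact hgy.ne rfl)
  -- a vertex of `T₂` has `v` uncoloured and sees the colour of `x` and `y` twice
  obtain ⟨ψ₂, hp₂, he₂, hc₂⟩ := hp₁.exists_extend T₂ (by
    intro z hz
    obtain ⟨hzU, hzx, hzy⟩ := mem_filter.1 hz
    refine ⟨{v, x}, ?_, ?_⟩
    · rw [card_pair hvx]
      have := hD z
      omega
    · intro r hr
      rw [mem_insert, mem_singleton] at hr
      rcases hr with rfl | rfl
      · exact ⟨hvT₂, (mem_soleSet.1 hzU).1.symm, Or.inl ((he₁ _ hvT₁).trans hψv)⟩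
      · refine ⟨hxT₂, hzx, Or.inr ⟨y, hzy, by simp [hvy.symm, hne.symm], hyT₂, ?_⟩⟩
        rw [he₁ _ hyT₁, he₁ _ hxT₁, hψxy _ (Or.inl rfl), hψxy _ (Or.inr rfl)])
  -- `v` sees that colour twice, and also the repeated colour if `v` has `k + 1` neighbours
  have hold : ∀ z, z ∉ soleSet G φ v → ψ₂ z = ψ z := by
    intro z hz
    rw [he₂ _ (fun hm => hz (mem_filter.1 hm).1), he₁ _ (fun hm => hz (mem_filter.1 hm).1)]
  have hψ₂xy : ψ₂ y = ψ₂ x := by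
    rw [he₂ _ hyT₂, he₂ _ hxT₂, he₁ _ hyT₁, he₁ _ hxT₁, hψxy _ (Or.inl rfl), hψxy _ (Or.inr rfl)]
  obtain ⟨ψ₃, hp₃, he₃, hc₃⟩ := hp₂.exists_extend {v} (by
    intro z hz
    rw [mem_singleton] at hz
    subst hz
    rcases h.sole_or_pair hN hD with ⟨-, hcard⟩ | ⟨p, q, hpq, hcol, hpU, hqU, heq, -⟩
    · refine ⟨{x}, by simp [hcard], fun r hr => ?_⟩
      rw [mem_singleton] at hr
      subst hr
      exact ⟨by simpa using hvx.symm, hxs.1,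
        Or.inr ⟨y, hys.1, by simpa using hne.symm, by simpa using hvy.symm, hψ₂xy⟩⟩
    · have hp : G.Adj z p := by rw [← SimpleGraph.mem_neighborFinset, heq]; simp
      have hq : G.Adj z q := by rw [← SimpleGraph.mem_neighborFinset, heq]; simp
      have hpx : p ≠ x := by rintro rfl; exact hpU hx
      have hpy : p ≠ y := by rintro rfl; exact hpU hy
      have hqx : q ≠ x := by rintro rfl; exact hqU hx
      refine ⟨{x, p}, ?_, fun r hr => ?_⟩
      · rw [card_pair hpx.symm]
        have := hD z
        omega
      · rw [mem_insert, mem_singleton] at hr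
        rcases hr with rfl | rfl
        · exact ⟨by simpa using hvx.symm, hxs.1,
            Or.inr ⟨y, hys.1, by simp [hne.symm, hpy.symm], by simpa using hvy.symm, hψ₂xy⟩⟩
        · refine ⟨by simpa using hp.ne', hp, Or.inr ⟨q, hq, by simp [hqx, hpq.symm],
            by simpa using hq.ne', ?_⟩⟩
          rw [hold _ hqU, hold _ hpU, hψφ _ (not_or.2 ⟨hq.ne', hqU⟩),
            hψφ _ (not_or.2 ⟨hp.ne', hpU⟩), hcol])
  obtain ⟨z, hz⟩ := hp₃.exists_eq_none hN
  have hzv : z ≠ v := by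
    rintro rfl
    exact hc₃ _ (mem_singleton_self _) hz
  rw [he₃ z (by simpa using hzv)] at hz
  by_cases hzT₂ : z ∈ T₂
  · exact hc₂ z hzT₂ hz
  rw [he₂ z hzT₂] at hz
  by_cases hzT₁ : z ∈ T₁
  · exact hc₁ z hzT₁ hz
  rw [he₁ z hzT₁] at hz
  by_cases hzxy : z = x ∨ z = y
  · rw [hψxy z hzxy] at hz
    cases hz
  · have hzU : z ∉ soleSet G φ v := by
      intro hm
      push Not at hzxy
      by_cases hg : G.Adj z x ∧ G.Adj z y
      · exact hzT₂ (mem_filter.2 ⟨hm, hg⟩)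
      · exact hzT₁ (mem_filter.2 ⟨hm, hzxy.1, hzxy.2, hg⟩)
    rw [hψφ z (not_or.2 ⟨hzv, hzU⟩)] at hz
    exact h.ne_none hzv hz

end

section

variable {V : Type*} [Fintype V] [DecidableEq V] {G : SimpleGraph V} [DecidableRel G.Adj] {k : ℕ}
  {φ : V → Option (Fin k)} {v : V}

/-! ### Weak and strong edges -/

/-- The neighbourhood of `v` consists of a clique `U` with `k - 1` vertices and of two further
non-adjacent vertices `p`, `q` such that every vertex of `U` is adjacent to `p` or `q`. -/
structure IsCliqueSplit (G : SimpleGraph V) (k : ℕ) (v : V) (U : Finset V) (p q : V) : Prop where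
  adj_iff : ∀ x, G.Adj v x ↔ x = p ∨ x = q ∨ x ∈ U
  left_notMem : p ∉ U
  right_notMem : q ∉ U
  ne : p ≠ q
  not_adj : ¬ G.Adj p q
  card : #U + 1 = k
  clique : ∀ x ∈ U, ∀ y ∈ U, x ≠ y → G.Adj x y
  cover : ∀ x ∈ U, G.Adj x p ∨ G.Adj x q

omit [Fintype V] [DecidableEq V] [DecidableRel G.Adj] in
lemma IsCliqueSplit.symm {U : Finset V} {p q : V} (h : IsCliqueSplit G k v U p q) :
    IsCliqueSplit G k v U q p :=
  ⟨fun x => by rw [h.adj_iff]; tauto, h.right_notMem, h.left_notMem, h.ne.symm,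
    fun ha => h.not_adj ha.symm, h.card, h.clique, fun x hx => (h.cover x hx).symm⟩

/-- If all colours around `v` were different, `v` and its neighbours would form a clique on `k + 1`
vertices; hence some pair `p`, `q` shares a colour. -/
lemma IsNearColoring.exists_isCliqueSplit (hG : IsChairFree G) (hN : ¬ G.Colorable k)
    (hD : ∀ x, #(G.neighborFinset x) ≤ k + 1) (hk : 8 ≤ k) (hK : G.CliqueFree (k + 1))
    (h : IsNearColoring G φ v) : ∃ U p q, IsCliqueSplit G k v U p q := by
  have hclique : ∀ x ∈ soleSet G φ v, ∀ y ∈ soleSet G φ v, x ≠ y → G.Adj x y :=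
    fun x hx y hy hne => h.sole_adj hG hN hD hk hx hy hne
  rcases h.sole_or_pair hN hD with ⟨heq, hcard⟩ | ⟨p, q, hpq, hcol, hpU, hqU, heq, hcard⟩
  · refine absurd ?_ (hK (insert v (soleSet G φ v)))
    refine SimpleGraph.IsNClique.insert ⟨?_, heq ▸ hcard⟩ fun b hb => (mem_soleSet.1 hb).1
    exact fun x hx y hy hne => hclique x hx y hy hne
  · exact ⟨soleSet G φ v, p, q, fun x => by
      rw [← SimpleGraph.mem_neighborFinset, heq, mem_insert, mem_insert], hpU, hqU, hpq,
      fun ha => h.proper p q ha hcol, hcard, hclique,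
      fun x hx => h.adj_or_adj hG hN hpq hcol heq hx⟩

omit [Fintype V] [DecidableRel G.Adj] in
lemma IsCliqueSplit.exists_not_adj (hK : G.CliqueFree (k + 1)) {U : Finset V} {p q : V}
    (h : IsCliqueSplit G k v U p q) : ∃ b ∈ U, ¬ G.Adj b p := by
  by_contra! hall
  have hvU : v ∉ U := fun hm => ((h.adj_iff v).2 (Or.inr (Or.inr hm))).ne rfl
  have hpU : G.IsNClique (#U + 1) (insert p U) :=
    SimpleGraph.IsNClique.insert ⟨fun x hx y hy hne => h.clique x hx y hy hne, rfl⟩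
      fun b hb => (hall b hb).symm
  have hv : G.IsNClique (#U + 1 + 1) (insert v (insert p U)) := by
    refine hpU.insert fun b hb => (h.adj_iff b).2 ?_
    rcases mem_insert.1 hb with rfl | hb
    · exact Or.inl rfl
    · exact Or.inr (Or.inr hb)
  rw [h.card] at hv
  exact hK _ hv

/-- One of `p`, `q` has few neighbours in `U`. Otherwise choose `b, c ∈ U` with `b` not adjacent
to `p` and `c` not adjacent to `q`, give `b`, `p` a common colour and `c`, `q` another one; then
every further vertex of `U` sees `v` uncoloured and one of the two colours twice, and `v` sees both
colours twice. -/
lemma IsCliqueSplit.not_large (hN : ¬ G.Colorable k)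
    (hD : ∀ x, #(G.neighborFinset x) ≤ k + 1) (hK : G.CliqueFree (k + 1))
    (hφ : IsNearColoring G φ v) {U : Finset V} {p q : V} (h : IsCliqueSplit G k v U p q)
    (hp2 : 2 ≤ #(U ∩ G.neighborFinset p)) (hq3 : 3 ≤ #(U ∩ G.neighborFinset q)) : False := by
  classical
  obtain ⟨b, hbU, hbp⟩ := h.exists_not_adj hK
  obtain ⟨c, hcU, hcq⟩ := h.symm.exists_not_adj hK
  have hbq : G.Adj b q := (h.cover b hbU).resolve_left hbp
  have hcp : G.Adj c p := (h.cover c hcU).resolve_right hcq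
  have hbc : b ≠ c := by rintro rfl; exact hcq hbq
  have hpU := h.left_notMem
  have hqU := h.right_notMem
  have hpq := h.ne
  have hvp : G.Adj v p := (h.adj_iff p).2 (Or.inl rfl)
  have hvq : G.Adj v q := (h.adj_iff q).2 (Or.inr (Or.inl rfl))
  have hvU : ∀ x ∈ U, G.Adj v x := fun x hx => (h.adj_iff x).2 (Or.inr (Or.inr hx))
  have hvnU : v ∉ U := fun hm => (hvU v hm).ne rfl
  have hcardU := h.card
  have hQ : ∀ x, x ∈ closedNbhd G v ↔ x = v ∨ x = p ∨ x = q ∨ x ∈ U := fun x => by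
    rw [mem_closedNbhd, h.adj_iff]
  -- the number of neighbours outside the closed neighbourhood of `v`
  have hout : ∀ r, G.Adj v r → #(U ∩ G.neighborFinset r) +
      #(G.neighborFinset r \ closedNbhd G v) ≤ k := by
    intro r hr
    have := card_add_card_sdiff_closedNbhd_le (v := v) hD (z := r)
      (S := insert v (U ∩ G.neighborFinset r)) (by
        intro s hs
        rw [mem_insert, mem_inter, SimpleGraph.mem_neighborFinset] at hs
        rw [hQ]
        rcases hs with rfl | hs
        · exact ⟨hr.symm, Or.inl rfl⟩
        · exact ⟨hs.2, Or.inr (Or.inr (Or.inr hs.1))⟩)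
    rw [card_insert_of_notMem (fun hm => hvnU (mem_inter.1 hm).1)] at this
    omega
  have hout' : ∀ x ∈ U, #(G.neighborFinset x \ closedNbhd G v) ≤ 1 := by
    intro x hx
    have hr : ∃ r, G.Adj x r ∧ (r = p ∨ r = q) := by
      rcases h.cover x hx with ha | ha
      · exact ⟨p, ha, Or.inl rfl⟩
      · exact ⟨q, ha, Or.inr rfl⟩
    obtain ⟨r, hxr, hr⟩ := hr
    have hrU : r ∉ U := by rcases hr with rfl | rfl <;> assumption
    have hvr : v ≠ r := by
      rcases hr with rfl | rfl
      · exact hvp.ne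
      · exact hvq.ne
    have := card_add_card_sdiff_closedNbhd_le (v := v) hD (z := x)
      (S := insert v (insert r (U.erase x))) (by
        intro s hs
        rw [mem_insert, mem_insert, mem_erase] at hs
        rw [hQ]
        rcases hs with rfl | rfl | hs
        · exact ⟨(hvU x hx).symm, Or.inl rfl⟩
        · exact ⟨hxr, by tauto⟩
        · exact ⟨h.clique x hx s hs.2 hs.1.symm, Or.inr (Or.inr (Or.inr hs.2))⟩)
    rw [card_insert_of_notMem (by simp [hvr, hvnU]), card_insert_of_notMem (by simp [hrU]),
      card_erase_of_mem hx] at this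
    have := card_pos.2 ⟨x, hx⟩
    omega
  have hfree : ∀ F : Finset (Option (Fin k)), ∀ r x, G.Adj v r → x ∈ U →
      #F + 2 ≤ #(U ∩ G.neighborFinset r) → ∃ α : Fin k, some α ∉ F ∧
        (∀ y, G.Adj r y → y ∉ closedNbhd G v → φ y ≠ some α) ∧
        (∀ y, G.Adj x y → y ∉ closedNbhd G v → φ y ≠ some α) := by
    intro F r x hr hx hF
    obtain ⟨α, hα⟩ := exists_color_notMem (F ∪ ((G.neighborFinset r \ closedNbhd G v).image φ ∪
        (G.neighborFinset x \ closedNbhd G v).image φ)) (by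
      have h1 := card_union_le F ((G.neighborFinset r \ closedNbhd G v).image φ ∪
        (G.neighborFinset x \ closedNbhd G v).image φ)
      have h2 := card_union_le ((G.neighborFinset r \ closedNbhd G v).image φ)
        ((G.neighborFinset x \ closedNbhd G v).image φ)
      have h3 := card_image_le (s := G.neighborFinset r \ closedNbhd G v) (f := φ)
      have h4 := card_image_le (s := G.neighborFinset x \ closedNbhd G v) (f := φ)
      have h5 := hout r hr
      have h6 := hout' x hx
      omega)
    simp only [mem_union, mem_image, mem_sdiff, SimpleGraph.mem_neighborFinset, not_or,
      not_exists, not_and] at hα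
    exact ⟨α, hα.1, fun y hy hyQ => hα.2.1 y ⟨hy, hyQ⟩, fun y hy hyQ => hα.2.2 y ⟨hy, hyQ⟩⟩
  obtain ⟨α, -, hαp, hαb⟩ := hfree ∅ p b hvp hbU (by simpa using hp2)
  obtain ⟨β, hβα, hβq, hβc⟩ := hfree {some α} q c hvq hcU (by simpa using hq3)
  rw [mem_singleton] at hβα
  let ψ : V → Option (Fin k) := fun z => if z = p ∨ z = b then some α else
    if z = q ∨ z = c then some β else if z ∈ closedNbhd G v then none else φ z
  have hψα : ∀ z, (z = p ∨ z = b) → ψ z = some α := fun z hz => if_pos hz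
  have hψβ : ∀ z, (z = q ∨ z = c) → ψ z = some β := by
    intro z hz
    have : ¬ (z = p ∨ z = b) := by
      rintro (rfl | rfl) <;> rcases hz with hz | hz
      · exact hpq hz
      · exact hpU (hz ▸ hcU)
      · exact hqU (hz ▸ hbU)
      · exact hbc hz
    simp only [ψ, if_neg this, if_pos hz]
  have hψnone : ∀ z, ¬ (z = p ∨ z = b) → ¬ (z = q ∨ z = c) → z ∈ closedNbhd G v → ψ z = none :=
    fun z h1 h2 h3 => by simp only [ψ, if_neg h1, if_neg h2, if_pos h3]
  have hψφ : ∀ z, z ∉ closedNbhd G v → ψ z = φ z := by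
    intro z hz
    rw [hQ] at hz
    have h1 : ¬ (z = p ∨ z = b) := by rintro (rfl | rfl) <;> tauto
    have h2 : ¬ (z = q ∨ z = c) := by rintro (rfl | rfl) <;> tauto
    rw [← hQ] at hz
    simp only [ψ, if_neg h1, if_neg h2, if_neg hz]
  have hclashα : ∀ x y, G.Adj x y → (x = p ∨ x = b) → ψ y ≠ some α := by
    intro x y hxy hx hy
    by_cases h1 : y = p ∨ y = b
    · rcases hx with rfl | rfl <;> rcases h1 with rfl | rfl
      · exact hxy.ne rfl
      · exact hbp hxy.symm
      · exact hbp hxy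
      · exact hxy.ne rfl
    by_cases h2 : y = q ∨ y = c
    · rw [hψβ y h2] at hy
      exact hβα hy
    by_cases h3 : y ∈ closedNbhd G v
    · rw [hψnone y h1 h2 h3] at hy
      cases hy
    · rw [hψφ y h3] at hy
      rcases hx with rfl | rfl
      · exact hαp y hxy h3 hy
      · exact hαb y hxy h3 hy
  have hclashβ : ∀ x y, G.Adj x y → (x = q ∨ x = c) → ψ y ≠ some β := by
    intro x y hxy hx hy
    by_cases h1 : y = p ∨ y = b
    · rw [hψα y h1] at hy
      exact hβα hy.symm
    by_cases h2 : y = q ∨ y = c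
    · rcases hx with rfl | rfl <;> rcases h2 with rfl | rfl
      · exact hxy.ne rfl
      · exact hcq hxy.symm
      · exact hcq hxy
      · exact hxy.ne rfl
    by_cases h3 : y ∈ closedNbhd G v
    · rw [hψnone y h1 h2 h3] at hy
      cases hy
    · rw [hψφ y h3] at hy
      rcases hx with rfl | rfl
      · exact hβq y hxy h3 hy
      · exact hβc y hxy h3 hy
  have hpart : IsPartialColoring G ψ := by
    intro x y hxy d hx hy
    by_cases hx1 : x = p ∨ x = b
    · exact hclashα x y hxy hx1 (hy.trans (hx.symm.trans (hψα x hx1)))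
    by_cases hy1 : y = p ∨ y = b
    · exact hclashα y x hxy.symm hy1 (hx.trans (hy.symm.trans (hψα y hy1)))
    by_cases hx2 : x = q ∨ x = c
    · exact hclashβ x y hxy hx2 (hy.trans (hx.symm.trans (hψβ x hx2)))
    by_cases hy2 : y = q ∨ y = c
    · exact hclashβ y x hxy.symm hy2 (hx.trans (hy.symm.trans (hψβ y hy2)))
    by_cases hx3 : x ∈ closedNbhd G v
    · rw [hψnone x hx1 hx2 hx3] at hx
      cases hx
    by_cases hy3 : y ∈ closedNbhd G v
    · rw [hψnone y hy1 hy2 hy3] at hy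
      cases hy
    rw [hψφ x hx3] at hx
    rw [hψφ y hy3] at hy
    exact hφ.proper x y hxy (hx.trans hy.symm)
  have hvb := hvU b hbU
  have hvc := hvU c hcU
  have hψv : ψ v = none := by
    refine hψnone v ?_ ?_ ((hQ v).2 (Or.inl rfl))
    · exact fun h => h.elim hvp.ne hvb.ne
    · exact fun h => h.elim hvq.ne hvc.ne
  set T : Finset V := (U.erase b).erase c with hT
  have hTmem : ∀ x, x ∈ T ↔ x ≠ c ∧ x ≠ b ∧ x ∈ U := fun x => by
    rw [hT, mem_erase, mem_erase]
  have hvT : v ∉ T := fun hm => hvnU ((hTmem v).1 hm).2.2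
  have hbT : b ∉ T := fun hm => ((hTmem b).1 hm).2.1 rfl
  have hcT : c ∉ T := fun hm => ((hTmem c).1 hm).1 rfl
  have hpT : p ∉ T := fun hm => hpU ((hTmem p).1 hm).2.2
  have hqT : q ∉ T := fun hm => hqU ((hTmem q).1 hm).2.2
  have hpb : p ≠ b := by rintro rfl; exact hpU hbU
  have hpc : p ≠ c := by rintro rfl; exact hpU hcU
  have hqb : q ≠ b := by rintro rfl; exact hqU hbU
  have hqc : q ≠ c := by rintro rfl; exact hqU hcU
  obtain ⟨ψ₁, hp₁, he₁, hc₁⟩ := hpart.exists_extend T (by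
    intro z hz
    obtain ⟨hzc, hzb, hzU⟩ := (hTmem z).1 hz
    rcases h.cover z hzU with hzp | hzq
    · refine ⟨{v, b}, by rw [card_pair hvb.ne]; have := hD z; omega, fun r hr => ?_⟩
      rw [mem_insert, mem_singleton] at hr
      rcases hr with rfl | rfl
      · exact ⟨hvT, (hvU z hzU).symm, Or.inl hψv⟩
      · refine ⟨hbT, h.clique z hzU _ hbU hzb, Or.inr ⟨p, hzp, ?_, hpT, ?_⟩⟩
        · simp [hvp.ne', hpb]
        · rw [hψα _ (Or.inl rfl), hψα _ (Or.inr rfl)]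
    · refine ⟨{v, c}, by rw [card_pair hvc.ne]; have := hD z; omega, fun r hr => ?_⟩
      rw [mem_insert, mem_singleton] at hr
      rcases hr with rfl | rfl
      · exact ⟨hvT, (hvU z hzU).symm, Or.inl hψv⟩
      · refine ⟨hcT, h.clique z hzU _ hcU hzc, Or.inr ⟨q, hzq, ?_, hqT, ?_⟩⟩
        · simp [hvq.ne', hqc]
        · rw [hψβ _ (Or.inl rfl), hψβ _ (Or.inr rfl)])
  obtain ⟨ψ₂, hp₂, he₂, hc₂⟩ := hp₁.exists_extend {v} (by
    intro z hz
    rw [mem_singleton] at hz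
    subst hz
    refine ⟨{b, c}, by rw [card_pair hbc]; have := hD z; omega, fun r hr => ?_⟩
    rw [mem_insert, mem_singleton] at hr
    rcases hr with rfl | rfl
    · refine ⟨by simpa using hvb.ne', hvb, Or.inr ⟨p, hvp, by simp [hpb, hpc],
        by simpa using hvp.ne', ?_⟩⟩
      rw [he₁ _ hpT, he₁ _ hbT, hψα _ (Or.inl rfl), hψα _ (Or.inr rfl)]
    · refine ⟨by simpa using hvc.ne', hvc, Or.inr ⟨q, hvq, by simp [hqb, hqc],
        by simpa using hvq.ne', ?_⟩⟩
      rw [he₁ _ hqT, he₁ _ hcT, hψβ _ (Or.inl rfl), hψβ _ (Or.inr rfl)])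
  obtain ⟨z, hz⟩ := hp₂.exists_eq_none hN
  have hzv : z ≠ v := by
    rintro rfl
    exact hc₂ _ (mem_singleton_self _) hz
  rw [he₂ z (by simpa using hzv)] at hz
  by_cases hzT : z ∈ T
  · exact hc₁ z hzT hz
  rw [he₁ z hzT] at hz
  by_cases h1 : z = p ∨ z = b
  · rw [hψα z h1] at hz
    cases hz
  by_cases h2 : z = q ∨ z = c
  · rw [hψβ z h2] at hz
    cases hz
  have hzQ : z ∉ closedNbhd G v := by
    rw [hQ]
    rw [hTmem] at hzT
    tauto
  rw [hψφ z hzQ] at hz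
  exact hφ.ne_none hzv hz

/-- If `p` has at most one neighbour in `U`, then `vp` is the only edge at `v` with few common
neighbours. -/
lemma IsCliqueSplit.card_common (hK : G.CliqueFree (k + 1)) {U : Finset V} {p q : V}
    (h : IsCliqueSplit G k v U p q) (hp1 : #(U ∩ G.neighborFinset p) ≤ 1) :
    ∃ p, G.Adj v p ∧ (∃ c, G.Adj v c ∧ G.Adj p c) ∧
      #(G.neighborFinset v ∩ G.neighborFinset p) ≤ 1 ∧
      ∀ z, G.Adj v z → z ≠ p → k ≤ #(G.neighborFinset v ∩ G.neighborFinset z) + 2 := by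
  have hcardU := h.card
  refine ⟨p, (h.adj_iff p).2 (Or.inl rfl), ?_, (card_le_card ?_).trans hp1, ?_⟩
  · obtain ⟨c, hcU, hcq⟩ := h.symm.exists_not_adj hK
    exact ⟨c, (h.adj_iff c).2 (Or.inr (Or.inr hcU)), ((h.cover c hcU).resolve_right hcq).symm⟩
  · intro x hx
    rw [mem_inter, SimpleGraph.mem_neighborFinset, SimpleGraph.mem_neighborFinset, h.adj_iff] at hx
    obtain ⟨rfl | rfl | hxU, hpx⟩ := hx
    · exact absurd rfl hpx.ne
    · exact absurd hpx h.not_adj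
    · exact mem_inter.2 ⟨hxU, (G.mem_neighborFinset _ _).2 hpx⟩
  · intro z hz hzp
    rcases (h.adj_iff z).1 hz with h1 | rfl | hzU
    · exact absurd h1 hzp
    · have hle : #(U \ G.neighborFinset p) ≤ #(G.neighborFinset v ∩ G.neighborFinset z) := by
        refine card_le_card fun x hx => ?_
        rw [mem_sdiff, SimpleGraph.mem_neighborFinset] at hx
        rw [mem_inter, SimpleGraph.mem_neighborFinset, SimpleGraph.mem_neighborFinset, h.adj_iff]
        exact ⟨Or.inr (Or.inr hx.1),
          ((h.cover x hx.1).resolve_left fun ha => hx.2 ha.symm).symm⟩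
      have := card_sdiff_add_card_inter U (G.neighborFinset p)
      omega
    · have hle : #(U.erase z) ≤ #(G.neighborFinset v ∩ G.neighborFinset z) := by
        refine card_le_card fun x hx => ?_
        rw [mem_erase] at hx
        rw [mem_inter, SimpleGraph.mem_neighborFinset, SimpleGraph.mem_neighborFinset, h.adj_iff]
        exact ⟨Or.inr (Or.inr hx.2), h.clique z hzU x hx.2 hx.1.symm⟩
      rw [card_erase_of_mem hzU] at hle
      omega

/-- Every vertex lies on exactly one edge whose ends have few common neighbours. -/
lemma IsNearColoring.exists_weak (hG : IsChairFree G) (hN : ¬ G.Colorable k)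
    (hD : ∀ x, #(G.neighborFinset x) ≤ k + 1) (hk : 8 ≤ k) (hK : G.CliqueFree (k + 1))
    (h : IsNearColoring G φ v) :
    ∃ p, G.Adj v p ∧ (∃ c, G.Adj v c ∧ G.Adj p c) ∧
      #(G.neighborFinset v ∩ G.neighborFinset p) ≤ 1 ∧
      ∀ z, G.Adj v z → z ≠ p → k ≤ #(G.neighborFinset v ∩ G.neighborFinset z) + 2 := by
  obtain ⟨U, p, q, hs⟩ := h.exists_isCliqueSplit hG hN hD hk hK
  by_cases hp1 : #(U ∩ G.neighborFinset p) ≤ 1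
  · exact hs.card_common hK hp1
  by_cases hq1 : #(U ∩ G.neighborFinset q) ≤ 1
  · exact hs.symm.card_common hK hq1
  exfalso
  have hcardU := hs.card
  have hcov : #U ≤ #(U ∩ G.neighborFinset p) + #(U ∩ G.neighborFinset q) := by
    refine (card_le_card fun x hx => ?_).trans (card_union_le _ _)
    rw [mem_union, mem_inter, mem_inter, SimpleGraph.mem_neighborFinset,
      SimpleGraph.mem_neighborFinset]
    exact (hs.cover x hx).imp (fun ha => ⟨hx, ha.symm⟩) (fun ha => ⟨hx, ha.symm⟩)
  by_cases hq3 : 3 ≤ #(U ∩ G.neighborFinset q)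
  · exact hs.not_large hN hD hK h (by omega) hq3
  · exact hs.symm.not_large hN hD hK h (by omega) (by omega)

/-- A vertex-critical graph satisfying the hypotheses does not exist. Take the edge `vp` with a
single common neighbour `c`. The edges `cv` and `cp` have many common neighbours, and these two
sets are disjoint, which is too much for the degree of `c`. -/
lemma false_of_critical (hG : IsChairFree G) (hN : ¬ G.Colorable k)
    (hD : ∀ x, #(G.neighborFinset x) ≤ k + 1) (hk : 8 ≤ k) (hK : G.CliqueFree (k + 1)) (v : V)
    (hcrit : ∀ x, ∃ φ : V → Option (Fin k), IsNearColoring G φ x) : False := by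
  have hweak := fun x => (hcrit x).elim fun φ hφ => hφ.exists_weak hG hN hD hk hK
  obtain ⟨p, hvp, ⟨c, hvc, hpc⟩, hle, hz⟩ := hweak v
  obtain ⟨p', hpp', -, -, hz'⟩ := hweak p
  -- `v` is the exceptional neighbour of `p`
  have hp' : v = p' := by
    by_contra hne
    have := hz' v hvp.symm hne
    rw [inter_comm] at this
    omega
  have h1 := hz c hvc hpc.ne'
  have h2 := hz' c hpc (hp' ▸ hvc.ne')
  have hdis : Disjoint (G.neighborFinset v ∩ G.neighborFinset c)
      (G.neighborFinset p ∩ G.neighborFinset c) := by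
    refine disjoint_left.2 fun x hx hx' => ?_
    simp only [mem_inter, SimpleGraph.mem_neighborFinset] at hx hx'
    exact hx.2.ne (card_le_one.1 hle c (by simp [hvc, hpc]) x (by simp [hx.1, hx'.1]))
  have h3 := card_union_of_disjoint hdis
  have h4 := card_le_card (union_subset
    (inter_subset_right : G.neighborFinset v ∩ G.neighborFinset c ⊆ _)
    (inter_subset_right : G.neighborFinset p ∩ G.neighborFinset c ⊆ _))
  have h5 := hD c
  omega

end

/-! ### Induction on the number of vertices -/

theorem colorable_of_card_neighborFinset_le {V : Type*} [Fintype V] [DecidableEq V]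
    (G : SimpleGraph V) [DecidableRel G.Adj] {k : ℕ} (hG : IsChairFree G)
    (hD : ∀ x, #(G.neighborFinset x) ≤ k + 1) (hk : 8 ≤ k) (hK : G.CliqueFree (k + 1)) :
    G.Colorable k := by
  classical
  induction hn : Fintype.card V using Nat.strong_induction_on generalizing V with
  | _ n ih =>
    by_contra hN
    have hcrit : ∀ x, ∃ φ : V → Option (Fin k), IsNearColoring G φ x := by
      intro v
      let e := SimpleGraph.Embedding.induce (G := G) {x | x ≠ v}
      obtain ⟨C⟩ : (G.induce {x | x ≠ v}).Colorable k := by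
        refine ih _ ?_ (G.induce {x | x ≠ v}) ?_ ?_ (hK.comap ⟨e.toCopy⟩) rfl
        · rw [← hn]
          exact Fintype.card_subtype_lt (x := v) (by simp)
        · exact fun hi => hG (hi.trans ⟨e⟩)
        · intro x
          refine (card_le_card_of_injOn Subtype.val (fun y hy => ?_)
            Subtype.val_injective.injOn).trans (hD x.1)
          simp only [mem_coe, SimpleGraph.mem_neighborFinset] at hy ⊢
          exact hy
      refine ⟨fun x => if hx : x ≠ v then some (C ⟨x, hx⟩) else none, ?_, ?_⟩
      · intro x y hxy
        by_cases hx : x = v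
        · have hy : y ≠ v := fun hy => hxy.ne (hx.trans hy.symm)
          simp [hx, hy]
        · by_cases hy : y = v
          · simp [hx, hy]
          · have := C.valid (v := ⟨x, hx⟩) (w := ⟨y, hy⟩) hxy
            simpa [hx, hy] using this
      · intro x
        by_cases hx : x = v <;> simp [hx]
    obtain ⟨v⟩ : Nonempty V := by
      by_contra hempty
      rw [not_nonempty_iff] at hempty
      exact hN (SimpleGraph.Colorable.of_isEmpty k)
    exact false_of_critical hG hN hD hk hK v hcrit

end ChairFree

theorem mainTheorem1 {V : Type*} [Fintype V] (G : SimpleGraph V) [DecidableRel G.Adj]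
    (hchair : IsChairFree G) (hdeg : 9 ≤ G.maxDegree) :
    G.chromaticNumber ≤ ((max (G.maxDegree - 1) G.cliqueNum : ℕ) : ℕ∞) := by
  classical
  rw [SimpleGraph.chromaticNumber_le_iff_colorable]
  refine ChairFree.colorable_of_card_neighborFinset_le G hchair (fun x => ?_) (by omega) ?_
  · have := G.degree_le_maxDegree x
    rw [SimpleGraph.card_neighborFinset_eq_degree]
    omega
  · intro s hs
    have := hs.isClique.card_le_cliqueNum
    have := hs.card_eq
    omega
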